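/- Let $k$ be a field of characteristic $0$. A vertex algebra over $k$ is a $k$-vector space $V$ with a vector $\mathbf 1\in V$ and bilinear products $a_{(n)}b$ ($n\in\mathbb Z$) such that for all $a,b,c\in V$: $a_{(n)}b=0$ for $n\gg0$; $\mathbf 1_{(n)}a=\delta_{n,-1}a$; $a_{(-1)}\mathbf 1=a$ and $a_{(n)}\mathbf 1=0$ for $n\ge 0$; and for all $p,q,r\in\mathbb Z$ $$\sum_{j\ge0}\binom pj\Big((-1)^j a_{(p+q-j)}(b_{(r+j)}c)-(-1)^{j+p}\,b_{(r+p-j)}(a_{(q+j)}c)\Big)=\sum_{j\ge0}\binom qj (a_{(p+j)}b)_{(q+r-j)}c .$$ A $\mathbb Z_{\ge0}$-graded vertex algebra is a family $(H^i)_{i\ge0}$ of $k$-vector spaces with $\mathbf 1\in H^0$ and bilinear products ${}_{(n)}:H^i\times H^j\to H^{i+j}$ satisfying the same axioms for homogeneous $a,b,c$, where the term $(-1)^{j+p}b_{(r+p-j)}(a_{(q+j)}c)$ is multiplied by $(-1)^{\alpha\beta}$ for $a\in H^\alpha$, $b\in H^\beta$. Let $X$ be a topological space, or more generally a site with finite products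 (including a terminal object), and let $\mathcal V$ be a sheaf of vertex algebras on $X$: a sheaf of $k$-vector spaces with a vertex algebra structure on the sections over each object (each open set, if $X$ is a space) such that all restriction maps preserve $\mathbf 1$ and all the products. A covering $\mathcal U=(U_i)_{i\in I}$ is a covering family of $X$ (that is, of the terminal object), and $H^\bullet(\mathcal U,\mathcal V)$ denotes the cohomology of its Čech complex, which is $\prod_{i_0,\dots,i_p}\mathcal V(U_{i_0}\times\cdots\times U_{i_p})$ in degree $p$, with the alternating sum of the coface maps as differential (for a space, $\times$ is $\cap$). Then: 1. For each finite covering $\mathcal U$, $H^\bullet(\mathcal U,\mathcal V)$ is a $\mathbb Z_{\ge0}$-graded vertex algebra, with vacuum the class of $(\mathbf 1_{\mathcal V(U_i)})_i$ and with $[a]_{(n)}[b]=[a\cup_n b]$ for cocycles $a,b$ of degrees $p,q$, where $(a\cup_n b)_{i_0\dots i_{p+q}}=(a_{i_0\dots i_p})_{(n)}(b_{i_p\dots i_{p+q}})$, the factors being restricted to $U_{i_0}\times\cdots\times U_{i_{p+q}}$. 2. The colimit of the $H^\bullet(\mathcal U,\mathcal V)$ over all finite coverings and refinement maps is a $\mathbb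 Z_{\ge0}$-graded vertex algebra, whose vacuum and products are given by the same formulas on classes of cocycles. 3. If $X$ is quasi-compact (each covering has a finite subcovering), then the Čech cohomology ${}^cH^\bullet(X,\mathcal V)$, the colimit of the $H^\bullet(\mathcal U,\mathcal V)$ over all coverings and refinement maps, is a $\mathbb Z_{\ge0}$-graded vertex algebra, whose vacuum and products are given by the same formulas on classes of cocycles of all coverings. -/

import Mathlib

open CategoryTheory Limits Opposite

universe w v u t

/-- A vertex algebra structure on a `k`-module `V`: a vacuum vector and bilinear products
`a, b ↦ a_(n) b` for all `n : ℤ`, subject to truncation, the vacuum axioms and the Borcherds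
identities.  All sums in the Borcherds identities are finite by truncation.
(The translation operator is the derived map `a ↦ a_(-2) vac`.) -/
structure VertexAlgebra (k : Type*) [Field k] (V : Type*) [AddCommGroup V] [Module k V] where
  /-- The vacuum vector. -/
  vac : V
  /-- The `n`-th product `a_(n) b`. -/
  prod : ℤ → V →ₗ[k] V →ₗ[k] V
  truncation : ∀ a b : V, ∃ N : ℤ, ∀ n : ℤ, N ≤ n → prod n a b = 0
  vac_prod : ∀ (n : ℤ) (a : V), prod n vac a = if n = -1 then a else 0
  prod_vac : ∀ a : V, prod (-1) a vac = a
  prod_vac_of_nonneg : ∀ (n : ℤ) (a : V), 0 ≤ n → prod n a vac = 0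
  borcherds : ∀ (p q r : ℤ) (a b c : V),
    ∑ᶠ j : ℕ, Ring.choose p j •
        ((j : ℤ).negOnePow • prod (p + q - j) a (prod (r + j) b c)
          - ((j : ℤ) + p).negOnePow • prod (r + p - j) b (prod (q + j) a c))
      = ∑ᶠ j : ℕ, Ring.choose q j • prod (q + r - j) (prod (p + j) a b) c

/-- A `ℤ_{≥0}`-graded vertex algebra structure on a family `H 0, H 1, H 2, …` of `k`-modules:
the products are homogeneous of degree `0` and the vacuum has degree `0`, and the
axioms of a vertex algebra hold with the Koszul sign rule, that is, interchanging elements of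
degrees `α` and `β` produces the sign `(-1)^{αβ}`.  Identities between elements of
`H i` and `H j`, where `i` and `j` are equal but not syntactically so,
are stated in the direct sum `⨁ i, H i`. -/
structure GradedVertexAlgebra (k : Type*) [Field k] (H : ℕ → Type*)
    [∀ i, AddCommGroup (H i)] [∀ i, Module k (H i)] where
  /-- The vacuum vector. -/
  vac : H 0
  /-- The `n`-th product `a_(n) b`. -/
  prod : ℤ → ∀ {i j : ℕ}, H i →ₗ[k] H j →ₗ[k] H (i + j)
  truncation : ∀ {i j : ℕ} (a : H i) (b : H j), ∃ N : ℤ, ∀ n : ℤ, N ≤ n → prod n a b = 0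
  vac_prod : ∀ (n : ℤ) {i : ℕ} (a : H i),
    DirectSum.of H _ (prod n vac a) = if n = -1 then DirectSum.of H _ a else 0
  prod_vac : ∀ {i : ℕ} (a : H i), DirectSum.of H _ (prod (-1) a vac) = DirectSum.of H _ a
  prod_vac_of_nonneg : ∀ (n : ℤ) {i : ℕ} (a : H i), 0 ≤ n → prod n a vac = 0
  borcherds : ∀ (p q r : ℤ) {α β γ : ℕ} (a : H α) (b : H β) (c : H γ),
    ∑ᶠ j : ℕ, Ring.choose p j •
        ((j : ℤ).negOnePow • DirectSum.of H _ (prod (p + q - j) a (prod (r + j) b c))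
          - ((j : ℤ) + p + α * β).negOnePow •
              DirectSum.of H _ (prod (r + p - j) b (prod (q + j) a c)))
      = ∑ᶠ j : ℕ, Ring.choose q j •
          DirectSum.of H _ (prod (q + r - j) (prod (p + j) a b) c)

/-- A sheaf of vertex algebras over `k` on a site: a sheaf of `k`-modules, with a vertex algebra
structure on the sections over each object, such that the restriction maps are homomorphisms of
vertex algebras. -/
structure VertexAlgebraSheaf {C : Type u} [Category.{v} C] (J : GrothendieckTopology C)
    (k : Type t) [Field k] where
  /-- The underlying sheaf of modules. -/
  sheaf : Sheaf J (ModuleCat.{w} k)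
  /-- The vertex algebra structure on the sections over `U`. -/
  str : ∀ U : C, VertexAlgebra k (sheaf.obj.obj (op U))
  map_vac : ∀ {U V : C} (f : U ⟶ V), sheaf.obj.map f.op (str V).vac = (str U).vac
  map_prod : ∀ {U V : C} (f : U ⟶ V) (n : ℤ) (a b : sheaf.obj.obj (op V)),
    sheaf.obj.map f.op ((str V).prod n a b)
      = (str U).prod n (sheaf.obj.map f.op a) (sheaf.obj.map f.op b)

namespace VertexAlgebraSheaf

variable {C : Type u} [Category.{v} C] [HasFiniteProducts C] {J : GrothendieckTopology C}
  {k : Type t} [Field k]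

/-- The Čech complexes of the presheaf underlying `𝒱`, as a functor of the family of objects
`𝒰 = (U_i)_{i ∈ I}`; a morphism `𝒰' ⟶ 𝒰` of families is a map `φ : I' → I` with
morphisms `U'_i ⟶ U_{φ i}`, i.e. a refinement map.
In degree `p` the complex is `∏_{i_0, …, i_p} 𝒱(U_{i_0} × ⋯ × U_{i_p})`, and the
differential is the alternating sum of the coface maps. -/
noncomputable def cechComplex (𝒱 : VertexAlgebraSheaf.{w} J k) :
    (FormalCoproduct.{w} C)ᵒᵖ ⥤ CochainComplex (ModuleCat.{w} k) ℕ :=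
  FormalCoproduct.cechFunctor.op ⋙ (simplicialCosimplicialEquiv _).functor ⋙
    (CosimplicialObject.whiskering _ _).obj
      ((FormalCoproduct.evalOp.{w} C (ModuleCat.{w} k)).obj 𝒱.sheaf.obj) ⋙
    AlgebraicTopology.alternatingCofaceMapComplex _

/-- The Čech cohomology `H^p(𝒰, 𝒱)` of the family `𝒰`, as a functor of `𝒰`. -/
noncomputable def cechFunctor (𝒱 : VertexAlgebraSheaf.{w} J k) (p : ℕ) :
    (FormalCoproduct.{w} C)ᵒᵖ ⥤ ModuleCat.{w} k :=
  𝒱.cechComplex ⋙ HomologicalComplex.homologyFunctor _ _ p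

/-- The Čech cohomology `H^p(𝒰, 𝒱)` of the family `𝒰`. -/
noncomputable abbrev familyCohomology (𝒱 : VertexAlgebraSheaf.{w} J k)
    (𝒰 : FormalCoproduct.{w} C) (p : ℕ) : ModuleCat.{w} k :=
  (𝒱.cechFunctor p).obj (op 𝒰)

/-- The module of Čech `p`-cocycles of the family `𝒰`. -/
noncomputable abbrev cocycles (𝒱 : VertexAlgebraSheaf.{w} J k)
    (𝒰 : FormalCoproduct.{w} C) (p : ℕ) : ModuleCat.{w} k :=
  (𝒱.cechComplex.obj (op 𝒰)).cycles p

/-- The cohomology class of a cocycle. -/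
noncomputable def cocycleClass (𝒱 : VertexAlgebraSheaf.{w} J k)
    (𝒰 : FormalCoproduct.{w} C) (p : ℕ) :
    𝒱.cocycles 𝒰 p →ₗ[k] 𝒱.familyCohomology 𝒰 p :=
  ((𝒱.cechComplex.obj (op 𝒰)).homologyπ p).hom

/-- The component of a Čech `p`-cocycle at `(i_0, …, i_p)`, a section
over `U_{i_0} × ⋯ × U_{i_p}`. -/
noncomputable def component (𝒱 : VertexAlgebraSheaf.{w} J k) (𝒰 : FormalCoproduct.{w} C)
    {p : ℕ} (a : 𝒱.cocycles 𝒰 p) (i : Fin (p + 1) → 𝒰.I) :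
    𝒱.sheaf.obj.obj (op (∏ᶜ fun l => 𝒰.obj (i l))) :=
  Pi.π (fun i : Fin (p + 1) → 𝒰.I => 𝒱.sheaf.obj.obj (op (∏ᶜ fun l => 𝒰.obj (i l)))) i
    ((𝒱.cechComplex.obj (op 𝒰)).iCycles p a)

/-- For a tuple of indices `i` and a map `f` of positions, the restriction map from
the sections over `∏_l U_{i (f l)}` to the sections over `∏_m U_{i m}`. -/
noncomputable def restrict (𝒱 : VertexAlgebraSheaf.{w} J k) (𝒰 : FormalCoproduct.{w} C)
    {m n : ℕ} (f : Fin m → Fin n) (i : Fin n → 𝒰.I) :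
    𝒱.sheaf.obj.obj (op (∏ᶜ fun l => 𝒰.obj (i (f l)))) →ₗ[k]
      𝒱.sheaf.obj.obj (op (∏ᶜ fun l => 𝒰.obj (i l))) :=
  (𝒱.sheaf.obj.map
    (Pi.lift fun l => Pi.π (fun l => 𝒰.obj (i l)) (f l)).op).hom

/-- The `0`-cocycle `e` is the family of the vacuum vectors of the `𝒱(U_i)`. -/
def IsVacuum (𝒱 : VertexAlgebraSheaf.{w} J k) (𝒰 : FormalCoproduct.{w} C)
    (e : 𝒱.cocycles 𝒰 0) : Prop :=
  ∀ i : Fin 1 → 𝒰.I, 𝒱.component 𝒰 e i = (𝒱.str _).vac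

/-- The cocycle `c` is the `n`-th cup product of the cocycles `a` and `b`, that is,
`c_{i_0 … i_{p+q}} = (a_{i_0 … i_p})_(n) (b_{i_p … i_{p+q}})` for all indices, where the factors on
the right are restricted to `U_{i_0} × ⋯ × U_{i_{p+q}}`. -/
def IsCupProduct (𝒱 : VertexAlgebraSheaf.{w} J k) (𝒰 : FormalCoproduct.{w} C)
    (n : ℤ) {p q : ℕ} (a : 𝒱.cocycles 𝒰 p) (b : 𝒱.cocycles 𝒰 q)
    (c : 𝒱.cocycles 𝒰 (p + q)) : Prop :=
  ∀ i : Fin (p + q + 1) → 𝒰.I,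
    𝒱.component 𝒰 c i =
      (𝒱.str _).prod n
        (𝒱.restrict 𝒰 (fun l : Fin (p + 1) => (⟨l, by omega⟩ : Fin (p + q + 1))) i
          (𝒱.component 𝒰 a _))
        (𝒱.restrict 𝒰 (fun l : Fin (q + 1) => (⟨p + l, by omega⟩ : Fin (p + q + 1))) i
          (𝒱.component 𝒰 b _))

/-- A graded vertex algebra structure `S` on `H`, where `H` receives linear maps `f p` from the Čech
cohomology of the family `𝒰`, is induced by `𝒱` along `f`: its vacuum is the image of the
class of the family of the vacuum vectors, and its products of images of classes of cocycles are the
images of the classes of the cup products of these cocycles. -/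
def IsInduced (𝒱 : VertexAlgebraSheaf.{w} J k) (𝒰 : FormalCoproduct.{w} C)
    {H : ℕ → Type*} [∀ p, AddCommGroup (H p)] [∀ p, Module k (H p)]
    (S : GradedVertexAlgebra k H) (f : ∀ p, 𝒱.familyCohomology 𝒰 p →ₗ[k] H p) : Prop :=
  (∃ e : 𝒱.cocycles 𝒰 0, 𝒱.IsVacuum 𝒰 e ∧ S.vac = f 0 (𝒱.cocycleClass 𝒰 0 e)) ∧
  ∀ (n : ℤ) (p q : ℕ) (a : 𝒱.cocycles 𝒰 p) (b : 𝒱.cocycles 𝒰 q),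
    ∃ c : 𝒱.cocycles 𝒰 (p + q), 𝒱.IsCupProduct 𝒰 n a b c ∧
      S.prod n (f p (𝒱.cocycleClass 𝒰 p a)) (f q (𝒱.cocycleClass 𝒰 q b))
        = f (p + q) (𝒱.cocycleClass 𝒰 (p + q) c)

open Classical in
/-- The submodule of `⨁_𝒰 H^p(𝒰, 𝒱)`, the sum over the families in the class `Q`, that identifies
each class in `H^p(𝒰, 𝒱)` with its images under the refinement maps. -/
noncomputable def refinementRelations (𝒱 : VertexAlgebraSheaf.{w} J k)
    (Q : ObjectProperty (FormalCoproduct.{w} C)) (p : ℕ) :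
    Submodule k (DirectSum Q.FullSubcategory fun 𝒰 => 𝒱.familyCohomology 𝒰.obj p) :=
  Submodule.span k {z | ∃ (𝒰 𝒰' : Q.FullSubcategory) (φ : 𝒰'.obj ⟶ 𝒰.obj)
    (y : 𝒱.familyCohomology 𝒰.obj p),
      z = DirectSum.lof k Q.FullSubcategory (fun 𝒰 => 𝒱.familyCohomology 𝒰.obj p) 𝒰'
            ((𝒱.cechFunctor p).map φ.op y)
          - DirectSum.lof k Q.FullSubcategory (fun 𝒰 => 𝒱.familyCohomology 𝒰.obj p) 𝒰 y}

/-- The colimit of the Čech cohomology modules `H^p(𝒰, 𝒱)` over the families `𝒰` in the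
class `Q` and the refinement maps between them. -/
noncomputable def cohomologyColimit (𝒱 : VertexAlgebraSheaf.{w} J k)
    (Q : ObjectProperty (FormalCoproduct.{w} C)) (p : ℕ) : ModuleCat.{max u (w + 1)} k :=
  ModuleCat.of k (DirectSum Q.FullSubcategory (fun 𝒰 => 𝒱.familyCohomology 𝒰.obj p) ⧸
    𝒱.refinementRelations Q p)

open Classical in
/-- The canonical map from `H^p(𝒰, 𝒱)` to the colimit. -/
noncomputable def toColimit (𝒱 : VertexAlgebraSheaf.{w} J k)
    (Q : ObjectProperty (FormalCoproduct.{w} C)) (𝒰 : Q.FullSubcategory) (p : ℕ) :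
    𝒱.familyCohomology 𝒰.obj p →ₗ[k] 𝒱.cohomologyColimit Q p :=
  (𝒱.refinementRelations Q p).mkQ ∘ₗ
    DirectSum.lof k Q.FullSubcategory (fun 𝒰 => 𝒱.familyCohomology 𝒰.obj p) 𝒰

end VertexAlgebraSheaf

namespace CategoryTheory.GrothendieckTopology

variable {C : Type u} [Category.{v} C]

/-- The coverings of a site: the families of objects that cover the terminal object. -/
def coverings (J : GrothendieckTopology C) : ObjectProperty (FormalCoproduct.{w} C) :=
  fun 𝒰 => J.CoversTop 𝒰.obj

/-- The finite coverings of a site. -/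
def finiteCoverings (J : GrothendieckTopology C) : ObjectProperty (FormalCoproduct.{w} C) :=
  fun 𝒰 => J.CoversTop 𝒰.obj ∧ Finite 𝒰.I

/-- A site is quasi-compact if each covering has a finite subcovering. -/
def IsQuasiCompact (J : GrothendieckTopology C) : Prop :=
  ∀ (I : Type w) (U : I → C), J.CoversTop U → ∃ s : Finset I, J.CoversTop fun i : s => U i

end CategoryTheory.GrothendieckTopology

/-! The Borcherds identities contain three nested products, `a(bc)`, `(ab)c` and `b(ac)`. For Čech
cocycles `a`, `b`, `c`, the components of the nested cup products `a(bc)` and `(ab)c` are formed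
from the same three sections: `a` on the first block of indices, `b` on the next, `c` on the last,
neighbouring blocks sharing one index. For these the identity in the vertex algebra of sections
applies directly. In `b(ac)`, however, `b` occupies the block in front of `a`. So the point is that
two adjacent factors may be interchanged at the cost of the Koszul sign and a coboundary
(`trilinear_cup_sub_mem`).

The products are neither commutative nor associative, so this is proved for arbitrary natural
pairings: `a ∪ b` for a pairing is cohomologous to `(-1)^{pq} b ∪ a` for the flipped pairing
(`Pairing.cup_sub_flip_cup_mem`). Applied to the universal pairing into a tensor product and
followed by a cup product with `c`, this gives the trilinear version. The bilinear statement holds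
because reversing the indices, with a suitable sign, is a chain map that exchanges the two cup
products and is homotopic to the identity. Čech cochains on all tuples of indices are functorial for
all maps of finite sets, so reversal makes sense, and the homotopy comes from a natural induction
over the décalage (`Operation.homotopy_d`).

The products and the vacuum axioms need no finiteness. Truncation and the finite form of the
Borcherds identities need one bound for all index tuples, which exists when the family is finite. In
the colimits, coverings have common refinements and each has a finite refinement in the class, so
any three classes live on one finite covering and inherit the axioms from it. -/

/-- A covariant system of `k`-modules `K 0, K 1, …` indexed by the finite sets `Fin n` and all maps
between them: an augmented symmetric cosimplicial module, where `K (p + 1)` is in degree `p`. -/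
structure SymModule (k : Type t) [Field k] where
  /-- The module attached to the set `Fin n`. -/
  obj : ℕ → Type w
  [addCommGroup : ∀ n, AddCommGroup (obj n)]
  [module : ∀ n, Module k (obj n)]
  /-- The functoriality. -/
  map : ∀ {m n : ℕ}, (Fin m → Fin n) → obj m →ₗ[k] obj n
  map_id : ∀ {n : ℕ} (x : obj n), map (id : Fin n → Fin n) x = x
  map_map : ∀ {l m n : ℕ} (g : Fin m → Fin n) (f : Fin l → Fin m) (x : obj l),
    map g (map f x) = map (g ∘ f) x

/-! ### Differentials, décalage and natural homotopies. -/

namespace SymModule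

attribute [instance] addCommGroup module

variable {k : Type t} [Field k]

/-- The maps of systems. -/
structure Hom (K L : SymModule.{w} k) where
  /-- The components. -/
  app : ∀ n, K.obj n →ₗ[k] L.obj n
  app_map : ∀ {m n : ℕ} (f : Fin m → Fin n) (x : K.obj m), app n (K.map f x) = L.map f (app m x)

/-- The `i`-th coface map, which omits the value `i`. -/
def coface {m : ℕ} (i : ℕ) : Fin m → Fin (m + 1) :=
  fun l => ⟨if l.1 < i then l.1 else l.1 + 1, by split_ifs <;> omega⟩

/-- The differential. -/
def d (K : SymModule.{w} k) (m : ℕ) : K.obj m →ₗ[k] K.obj (m + 1) :=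
  ∑ i ∈ Finset.range (m + 1), ((-1 : ℤ) ^ i) • K.map (coface i)

lemma d_apply (K : SymModule.{w} k) (m : ℕ) (x : K.obj m) :
    K.d m x = ∑ i ∈ Finset.range (m + 1), ((-1 : ℤ) ^ i) • K.map (coface i) x := by
  simp [d, LinearMap.sum_apply]

lemma Hom.app_d {K L : SymModule.{w} k} (φ : Hom K L) (m : ℕ) (x : K.obj m) :
    φ.app (m + 1) (K.d m x) = L.d m (φ.app m x) := by
  simp [d_apply, φ.app_map]

/-- Adjoining a new first element to source and target. -/
def consMap {m n : ℕ} (f : Fin m → Fin n) : Fin (m + 1) → Fin (n + 1) :=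
  Fin.cons 0 (Fin.succ ∘ f)

/-- The décalage of a system. -/
@[reducible] def dec (K : SymModule.{w} k) : SymModule.{w} k where
  obj n := K.obj (n + 1)
  map f := K.map (consMap f)
  map_id x := by
    convert K.map_id x
    ext i; refine Fin.cases ?_ (fun i => ?_) i <;> simp [consMap]
  map_map g f x := by
    rw [K.map_map]
    congr 2
    ext i; refine Fin.cases ?_ (fun i => ?_) i <;> simp [consMap]

/-- The canonical map from a system to its décalage. -/
@[reducible] def toDec (K : SymModule.{w} k) : Hom K K.dec where
  app _ := K.map Fin.succ
  app_map f x := by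
    rw [K.map_map]
    change _ = K.map (consMap f) (K.map Fin.succ x)
    rw [K.map_map]
    congr 2

/-- The zeroth coface is `Fin.succ`; the others fix the first element and are the cofaces of the
décalage with opposite sign. This recursion drives the inductions on the degree below. -/
lemma d_succ (K : SymModule.{w} k) (m : ℕ) (x : K.obj (m + 1)) :
    K.d (m + 1) x = K.toDec.app (m + 1) x - K.dec.d m x := by
  rw [d_apply, d_apply, Finset.sum_range_succ', sub_eq_neg_add, ← Finset.sum_neg_distrib]
  refine (add_comm _ _).trans ((congrArg₂ (· + ·) ?_ ?_).trans (add_comm _ _))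
  · have : (coface 0 : Fin (m + 1) → Fin (m + 2)) = Fin.succ := by ext i; simp [coface]
    simp [this]
  · refine Finset.sum_congr rfl fun i _ => ?_
    have : (coface (i + 1) : Fin (m + 1) → Fin (m + 2)) = consMap (coface i) := by
      ext l; refine Fin.cases ?_ (fun l => ?_) l
      · simp [coface, consMap]
      · simp only [coface, consMap, Fin.val_succ, Fin.cons_succ, Function.comp]
        split_ifs <;> omega
    rw [this, pow_succ]
    simp

/-- The induction runs over all systems at once: by `d_succ` the claim follows from the one for the
décalage, since `toDec` commutes with the differentials. -/
lemma d_d (K : SymModule.{w} k) (m : ℕ) (x : K.obj m) : K.d (m + 1) (K.d m x) = 0 := by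
  induction m generalizing K with
  | zero =>
    rw [d_apply, d_apply]
    simp only [Finset.sum_range_succ, Finset.sum_range_zero, map_add]
    -- The two terms of the double differential agree and carry opposite signs.
    have : (coface 1 ∘ coface 0 : Fin 0 → Fin 2) = coface 0 ∘ coface 0 := by
      ext l; exact l.elim0
    simp [K.map_map, this]
  | succ m ih =>
    have h1 := K.toDec.app_d (m + 1) x
    have h2 : K.dec.d (m + 1) (K.dec.d m x) = 0 := ih K.dec x
    have h3 : K.dec.d (m + 1) (K.d (m + 1) x) = K.dec.d (m + 1) (K.toDec.app (m + 1) x) := by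
      rw [d_succ K m x]
      exact (map_sub (K.dec.d (m + 1)) _ _).trans (by rw [h2, sub_zero])
    rw [d_succ K (m + 1), h3, h1, sub_self]

/-- A natural family of endomorphisms of the underlying modules which commutes with the
differentials and vanishes on `K 0`. -/
structure Operation (k : Type t) [Field k] where
  /-- The endomorphisms. -/
  app : ∀ (K : SymModule.{w} k) (m : ℕ), K.obj m →ₗ[k] K.obj m
  natural : ∀ {K L : SymModule.{w} k} (φ : Hom K L) (m : ℕ) (x : K.obj m),
    φ.app m (app K m x) = app L m (φ.app m x)
  app_d : ∀ (K : SymModule.{w} k) (m : ℕ) (x : K.obj m),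
    app K (m + 1) (K.d m x) = K.d m (app K m x)
  app_zero : ∀ (K : SymModule.{w} k) (x : K.obj 0), app K 0 x = 0

namespace Operation

/-- The contracting homotopy of an operation. -/
def homotopy (s : Operation.{w} k) : ∀ (m : ℕ) (K : SymModule.{w} k), K.obj (m + 1) →ₗ[k] K.obj m
  -- There is no map `Fin 1 → Fin 0`, hence no retraction in this degree; zero is the right value
  -- because operations vanish on `K 0`.
  | 0, _ => 0
  -- `Fin.cons 0 id` is a left inverse of `Fin.succ`, so its image under `K` retracts the décalage
  -- onto `K` along `toDec`.
  | m + 1, K => K.map (Fin.cons 0 id : Fin (m + 2) → Fin (m + 1)) ∘ₗ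
      (s.app K.dec (m + 1) - K.dec.d m ∘ₗ s.homotopy m K.dec : K.dec.obj (m + 1) →ₗ[k] _)

lemma homotopy_succ (s : Operation.{w} k) (m : ℕ) (K : SymModule.{w} k) (x : K.obj (m + 2)) :
    s.homotopy (m + 1) K x = K.map (Fin.cons 0 id : Fin (m + 2) → Fin (m + 1))
      (s.app K.dec (m + 1) x - K.dec.d m (s.homotopy m K.dec x)) := rfl

lemma homotopy_natural (s : Operation.{w} k) (m : ℕ) {K L : SymModule.{w} k} (φ : Hom K L)
    (x : K.obj (m + 1)) : φ.app m (s.homotopy m K x) = s.homotopy m L (φ.app (m + 1) x) := by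
  induction m generalizing K L with
  | zero => simp [homotopy]
  | succ m ih =>
    let ψ : Hom K.dec L.dec :=
      { app := fun n => φ.app (n + 1)
        app_map := fun f x => φ.app_map (consMap f) x }
    rw [homotopy_succ, homotopy_succ, φ.app_map]
    congr 1
    have h1 := s.natural ψ (m + 1) x
    have h2 := ψ.app_d m (s.homotopy m K.dec x)
    have h3 := ih ψ x
    rw [h3] at h2
    rw [map_sub]
    exact congrArg₂ (· - ·) h1 h2

lemma homotopy_zero_d (s : Operation.{w} k) (K : SymModule.{w} k) (x : K.obj 0) :
    s.homotopy 0 K (K.d 0 x) = s.app K 0 x := by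
  rw [s.app_zero]; rfl

/-- The hypothesis says that `z = s - d h` on the décalage kills coboundaries. Hence `z (d x) = z
(toDec x)` by `d_succ`; naturality moves `toDec` outside, and the retraction removes it. -/
lemma homotopy_d_of_comp_d (s : Operation.{w} k) (m : ℕ) (K : SymModule.{w} k)
    (h : ∀ y : K.dec.obj m, s.app K.dec (m + 1) (K.dec.d m y)
      - K.dec.d m (s.homotopy m K.dec (K.dec.d m y)) = 0) (x : K.obj (m + 1)) :
    s.homotopy (m + 1) K (K.d (m + 1) x) = s.app K (m + 1) x - K.d m (s.homotopy m K x) := by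
  have h1 := s.natural K.toDec (m + 1) x
  have h2 := s.homotopy_natural m K.toDec x
  have h3 := K.toDec.app_d m (s.homotopy m K x)
  rw [h2] at h3
  have h4 : ∀ y : K.obj (m + 1),
      K.map (Fin.cons 0 id : Fin (m + 2) → Fin (m + 1)) (K.map Fin.succ y) = y := by
    intro y
    rw [K.map_map]
    exact K.map_id y
  have h5 := h x
  let z : K.dec.obj (m + 1) →ₗ[k] K.dec.obj (m + 1) :=
    s.app K.dec (m + 1) - K.dec.d m ∘ₗ s.homotopy m K.dec
  have h6 : z (K.d (m + 1) x) = z (K.toDec.app (m + 1) x) := by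
    rw [d_succ K m x]
    exact (map_sub z _ _).trans (by rw [show z (K.dec.d m x) = 0 from h5, sub_zero])
  calc _ = K.map (Fin.cons 0 id : Fin (m + 2) → Fin (m + 1)) (z (K.d (m + 1) x)) := rfl
    _ = K.map (Fin.cons 0 id : Fin (m + 2) → Fin (m + 1))
        (K.map Fin.succ (s.app K (m + 1) x - K.d m (s.homotopy m K x))) := by
      rw [h6, map_sub (K.map Fin.succ)]
      congr 1
      exact (congrArg₂ (· - ·) h1 h3).symm
    _ = _ := h4 _

/-- This is `h d + d h = s`. The same formula one degree lower, on the décalage, gives `(s - d h) d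
= s d - d s + d d h = 0`, which is what `homotopy_d_of_comp_d` requires. -/
lemma homotopy_d (s : Operation.{w} k) (m : ℕ) (K : SymModule.{w} k) (x : K.obj (m + 1)) :
    s.homotopy (m + 1) K (K.d (m + 1) x) = s.app K (m + 1) x - K.d m (s.homotopy m K x) := by
  refine s.homotopy_d_of_comp_d m K (fun y => ?_) x
  induction m generalizing K with
  | zero => rw [homotopy_zero_d, s.app_zero, map_zero, sub_zero, s.app_d, s.app_zero, map_zero]
  | succ m ih =>
    have := s.homotopy_d_of_comp_d m K.dec (ih K.dec 0) y
    rw [this, s.app_d, map_sub, d_d, sub_zero, sub_self]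

end Operation

/-- The coboundaries of degree `p`; there are none in degree `0`. -/
def coboundaries (K : SymModule.{w} k) : ∀ p : ℕ, Submodule k (K.obj (p + 1))
  | 0 => ⊥
  | p + 1 => LinearMap.range (K.d (p + 1))

lemma d_mem_coboundaries (K : SymModule.{w} k) (p : ℕ) (x : K.obj (p + 1)) :
    K.d (p + 1) x ∈ K.coboundaries (p + 1) := ⟨x, rfl⟩

/-- On cocycles the homotopy formula reads `s x = d (h x)`. In degree `0` the map `h` is zero, so `s
x = 0`, in accordance with `coboundaries` being `⊥` there. -/
lemma Operation.app_mem_coboundaries (s : Operation.{w} k) (K : SymModule.{w} k) (p : ℕ)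
    {x : K.obj (p + 1)} (hx : K.d (p + 1) x = 0) : s.app K (p + 1) x ∈ K.coboundaries p := by
  have h := s.homotopy_d p K x
  rw [hx, map_zero, eq_comm, sub_eq_zero] at h
  rw [h]
  cases p with
  | zero => exact (map_zero (K.d 0) : K.d 0 0 = 0) ▸ Submodule.zero_mem _
  | succ p => exact K.d_mem_coboundaries _ _

/-- The reversal of cochains, with the sign which makes it commute with the differentials. -/
def reversal (K : SymModule.{w} k) (m : ℕ) : K.obj m →ₗ[k] K.obj m :=
  ((-1 : ℤ) ^ m.choose 2) • K.map Fin.rev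

lemma reversal_apply (K : SymModule.{w} k) (m : ℕ) (x : K.obj m) :
    K.reversal m x = ((-1 : ℤ) ^ m.choose 2) • K.map Fin.rev x := rfl

/-- Reversal exchanges the cofaces `i` and `m - i`, whose signs differ by `(-1)^m`; this is also the
ratio of the signs of the reversals on `K (m + 1)` and `K m`. -/
lemma reversal_d (K : SymModule.{w} k) (m : ℕ) (x : K.obj m) :
    K.reversal (m + 1) (K.d m x) = K.d m (K.reversal m x) := by
  rw [reversal_apply, reversal_apply, d_apply, d_apply, ← Finset.sum_range_reflect, map_sum,
    Finset.smul_sum]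
  refine Finset.sum_congr rfl fun i hi => ?_
  have hi : i ≤ m := by simpa [Nat.lt_succ_iff] using hi
  rw [map_zsmul, map_zsmul, K.map_map, K.map_map, smul_smul, smul_smul]
  have h1 : (Fin.rev ∘ coface (m + 1 - 1 - i) : Fin m → Fin (m + 1)) = coface i ∘ Fin.rev := by
    ext l
    simp only [coface, Function.comp, Fin.val_rev]
    split_ifs <;> omega
  rw [h1]
  congr 1
  rw [← pow_add, ← pow_add]
  apply neg_one_pow_congr
  rw [show (m + 1).choose 2 = m + m.choose 2 by rw [Nat.choose_succ_succ' m 1]; simp]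
  simp only [Nat.even_iff]
  omega

/-- The difference of the reversal and the identity. -/
def reversalSubId : Operation.{w} k where
  app K m := K.reversal m - LinearMap.id
  natural φ m x := by simp [reversal_apply, φ.app_map]
  app_d K m x := by simp [reversal_d]
  app_zero K x := by
    have : (Fin.rev : Fin 0 → Fin 0) = id := by ext l; exact l.elim0
    simp [reversal_apply, this, K.map_id]

lemma reversal_sub_mem (K : SymModule.{w} k) (p : ℕ) {x : K.obj (p + 1)}
    (hx : K.d (p + 1) x = 0) : K.reversal (p + 1) x - x ∈ K.coboundaries p :=
  reversalSubId.app_mem_coboundaries K p hx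

end SymModule

/-! ### Cup products and their graded commutativity. -/

namespace SymModule

variable {k : Type t} [Field k]

/-- A natural bilinear pairing of systems. -/
structure Pairing (K L M : SymModule.{w} k) where
  /-- The components. -/
  app : ∀ n, K.obj n →ₗ[k] L.obj n →ₗ[k] M.obj n
  map_app : ∀ {m n : ℕ} (f : Fin m → Fin n) (x : K.obj m) (y : L.obj m),
    M.map f (app m x y) = app n (K.map f x) (L.map f y)

/-- The inclusion of an interval of positions that begins at `s`. -/
def interval (s : ℕ) {m n : ℕ} (h : s + m ≤ n) : Fin m → Fin n := fun l => ⟨s + l, by omega⟩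

/-- The inclusion of the first `m` positions. -/
def front {m n : ℕ} (h : m ≤ n) : Fin m → Fin n := fun l => ⟨l, by omega⟩

lemma interval_congr {m n s s' : ℕ} (h : s + m ≤ n) (e : s = s') :
    (interval s h : Fin m → Fin n) = interval s' (e ▸ h) := by
  subst e; rfl

lemma coface_comp_front_of_le {m n i : ℕ} (h : m ≤ n) (hi : m ≤ i) :
    coface i ∘ front h = front (by omega) := by
  ext l
  change (if l.1 < i then l.1 else l.1 + 1) = l.1
  split_ifs <;> omega

lemma coface_comp_front {m n i : ℕ} (h : m ≤ n) :
    coface i ∘ front h = front (by omega : m + 1 ≤ n + 1) ∘ coface i := rfl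

lemma coface_comp_interval_of_le {m n i s : ℕ} (h : s + m ≤ n) (hi : i ≤ s) :
    coface i ∘ interval s h = interval (s + 1) (by omega) := by
  ext l
  change (if s + l.1 < i then s + l.1 else s + l.1 + 1) = s + 1 + l.1
  split_ifs <;> omega

lemma coface_comp_interval_add {m n i s : ℕ} (h : s + m ≤ n) :
    coface (s + i) ∘ interval s h = interval s (by omega : s + (m + 1) ≤ n + 1) ∘ coface i := by
  ext l
  change (if s + l.1 < s + i then s + l.1 else s + l.1 + 1)
    = s + (if l.1 < i then l.1 else l.1 + 1)
  split_ifs <;> omega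

lemma front_comp_front {l m n : ℕ} (h : m ≤ n) (h' : l ≤ m) :
    front h ∘ front h' = front (by omega) := rfl

lemma front_comp_interval {l m n s : ℕ} (h : m ≤ n) (h' : s + l ≤ m) :
    front h ∘ interval s h' = interval s (by omega) := rfl

lemma interval_comp_front {l m n s : ℕ} (h : s + m ≤ n) (h' : l ≤ m) :
    interval s h ∘ front h' = interval s (by omega) := rfl

lemma interval_comp_interval {l m n s s' : ℕ} (h : s + m ≤ n) (h' : s' + l ≤ m) :
    interval s h ∘ interval s' h' = interval (s + s') (by omega) := by
  ext i; simp [interval, add_assoc]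

lemma rev_comp_front {m n : ℕ} (h : m ≤ n) :
    Fin.rev ∘ front h = interval (n - m) (by omega) ∘ Fin.rev := by
  ext l; simp only [front, interval, Function.comp, Fin.val_rev]; omega

lemma rev_comp_interval {m n s : ℕ} (h : s + m = n) :
    Fin.rev ∘ interval s h.le = front (by omega) ∘ Fin.rev := by
  ext l; simp only [front, interval, Function.comp, Fin.val_rev]; omega

namespace Pairing

variable {K L M : SymModule.{w} k}

/-- The pairing with the arguments interchanged. -/
def flip (B : Pairing K L M) : Pairing L K M where
  app n := (B.app n).flip
  map_app f x y := by simp [B.map_app]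

/-- The cup product of cochains of degrees `p` and `q`, of degree `N = p + q`. -/
def cup (B : Pairing K L M) {p q N : ℕ} (h : p + q = N) :
    K.obj (p + 1) →ₗ[k] L.obj (q + 1) →ₗ[k] M.obj (N + 1) :=
  (B.app (N + 1)).compl₁₂ (K.map (front (by omega))) (L.map (interval p (by omega)))

lemma cup_apply (B : Pairing K L M) {p q N : ℕ} (h : p + q = N) (a : K.obj (p + 1))
    (b : L.obj (q + 1)) : B.cup h a b = B.app (N + 1) (K.map (front (by omega)) a)
      (L.map (interval p (by omega)) b) := rfl

/-- The Leibniz rule. -/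
lemma d_cup (B : Pairing K L M) {p q N : ℕ} (h : p + q = N) (a : K.obj (p + 1))
    (b : L.obj (q + 1)) :
    M.d (N + 1) (B.cup h a b) = B.cup (N := N + 1) (by omega) (K.d (p + 1) a) b
      + ((-1 : ℤ) ^ p) • B.cup (N := N + 1) (by omega) a (L.d (q + 1) b) := by
  have e1 : ∀ i ∈ Finset.range (p + 1), ((-1 : ℤ) ^ i) • M.map (coface i) (B.cup h a b)
      = ((-1 : ℤ) ^ i) • B.cup (N := N + 1) (by omega) (K.map (coface i) a) b := by
    intro i hi
    have hi : i < p + 1 := by simpa using hi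
    rw [cup_apply, cup_apply, B.map_app, K.map_map, K.map_map, L.map_map,
      coface_comp_front, coface_comp_interval_of_le _ (by omega)]
  have e2 : ∀ i ∈ Finset.range (q + 1),
      ((-1 : ℤ) ^ (p + 1 + i)) • M.map (coface (p + 1 + i)) (B.cup h a b)
      = ((-1 : ℤ) ^ p) • ((-1 : ℤ) ^ (i + 1)) •
          B.cup (N := N + 1) (by omega) a (L.map (coface (i + 1)) b) := by
    intro i hi
    rw [cup_apply, cup_apply, B.map_app, K.map_map, L.map_map, L.map_map,
      coface_comp_front_of_le _ (by omega), smul_smul, ← pow_add,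
      show p + (i + 1) = p + 1 + i by omega]
    congr 4
    rw [show p + 1 + i = p + (i + 1) by omega, coface_comp_interval_add]
  -- In these two terms of the right side the blocks of `a` and `b` are disjoint. They do not occur
  -- on the left, and they cancel because of their signs `(-1)^(p+1)` and `(-1)^p`.
  have e3 : B.cup (N := N + 1) (by omega) (K.map (coface (p + 1)) a) b
      = B.cup (N := N + 1) (by omega) a (L.map (coface 0) b) := by
    rw [cup_apply, cup_apply, K.map_map, L.map_map,
      ← coface_comp_front (by omega), coface_comp_front_of_le _ le_rfl,
      ← coface_comp_interval_add (i := 0) (by omega), add_zero,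
      coface_comp_interval_of_le _ le_rfl]
  rw [d_apply, show Finset.range (N + 1 + 1) = Finset.range ((p + 1) + (q + 1)) by
      congr 1; omega, Finset.sum_range_add, Finset.sum_congr rfl e1, Finset.sum_congr rfl e2,
    d_apply, d_apply, map_sum, map_sum, LinearMap.sum_apply,
    Finset.sum_range_succ _ (p + 1), Finset.sum_range_succ' _ (q + 1), smul_add, Finset.smul_sum]
  simp only [map_zsmul, LinearMap.smul_apply, e3, pow_succ, pow_zero, one_smul]
  module

lemma d_cup_eq_zero (B : Pairing K L M) {p q N : ℕ} (h : p + q = N) {a : K.obj (p + 1)}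
    {b : L.obj (q + 1)} (ha : K.d (p + 1) a = 0) (hb : L.d (q + 1) b = 0) :
    M.d (N + 1) (B.cup h a b) = 0 := by
  rw [d_cup, ha, hb]; simp

lemma cup_mem_of_left (B : Pairing K L M) {p q N : ℕ} (h : p + q = N) {a : K.obj (p + 1)}
    {b : L.obj (q + 1)} (ha : a ∈ K.coboundaries p) (hb : L.d (q + 1) b = 0) :
    B.cup h a b ∈ M.coboundaries N := by
  cases p with
  | zero => rw [(Submodule.mem_bot k).1 ha]; simp
  | succ p =>
    obtain ⟨x, rfl⟩ := ha
    obtain ⟨N, rfl⟩ : ∃ N', N = N' + 1 := ⟨p + q, by omega⟩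
    have := B.d_cup (N := N) (by omega) x b
    rw [hb, map_zero, smul_zero, add_zero] at this
    rw [← this]
    exact M.d_mem_coboundaries _ _

lemma cup_mem_of_right (B : Pairing K L M) {p q N : ℕ} (h : p + q = N) {a : K.obj (p + 1)}
    {b : L.obj (q + 1)} (ha : K.d (p + 1) a = 0) (hb : b ∈ L.coboundaries q) :
    B.cup h a b ∈ M.coboundaries N := by
  cases q with
  | zero => rw [(Submodule.mem_bot k).1 hb]; simp
  | succ q =>
    obtain ⟨x, rfl⟩ := hb
    obtain ⟨N, rfl⟩ : ∃ N', N = N' + 1 := ⟨p + q, by omega⟩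
    have := B.d_cup (N := N) (by omega) a x
    rw [ha, map_zero, LinearMap.zero_apply, zero_add] at this
    have h2 := congrArg (fun z => ((-1 : ℤ) ^ p) • z) this
    simp only [smul_smul, ← pow_add, Even.neg_one_pow ⟨p, rfl⟩, one_smul] at h2
    rw [← h2]
    exact zsmul_mem (M.d_mem_coboundaries _ _) _

/-- Reversal exchanges the front block and the final block. The sign comes from `(p+q+1).choose 2 =
(p+1).choose 2 + (q+1).choose 2 + p*q`. -/
lemma reversal_cup (B : Pairing K L M) {p q N : ℕ} (h : p + q = N) (a : K.obj (p + 1))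
    (b : L.obj (q + 1)) :
    M.reversal (N + 1) (B.cup h a b) = ((-1 : ℤ) ^ (p * q)) •
      B.flip.cup (by omega) (L.reversal (q + 1) b) (K.reversal (p + 1) a) := by
  subst h
  simp only [reversal_apply, map_zsmul, LinearMap.smul_apply, smul_smul]
  rw [cup_apply, cup_apply, B.map_app, K.map_map, L.map_map, K.map_map, L.map_map,
    rev_comp_front, rev_comp_interval (by omega), flip, LinearMap.flip_apply]
  congr 1
  · rw [← pow_add, ← pow_add]
    congr 1
    have e : ∀ n : ℕ, ((n + 1).choose 2 : ℤ) * 2 = (n + 1) * n := fun n => by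
      have := Nat.triangle_succ n
      rw [Nat.choose_two_right]
      exact_mod_cast Nat.div_mul_cancel (even_iff_two_dvd.1 (Nat.even_mul_pred_self (n + 1)))
    have e1 := e (p + q)
    have e2 := e p
    have e3 := e q
    zify
    push_cast at *
    linarith
  · rw [interval_congr _ (by omega : p + q + 1 - (p + 1) = q)]

/-- Graded commutativity of the cup product of cocycles up to coboundaries. -/
lemma cup_sub_flip_cup_mem (B : Pairing K L M) {p q N : ℕ} (h : p + q = N) {a : K.obj (p + 1)}
    {b : L.obj (q + 1)} (ha : K.d (p + 1) a = 0) (hb : L.d (q + 1) b = 0) :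
    B.cup h a b - ((-1 : ℤ) ^ (p * q)) • B.flip.cup (by omega) b a ∈ M.coboundaries N := by
  -- The cup product is cohomologous to its reversal, which is the flipped cup product of the
  -- reversed factors; `h2` and `h3` then replace each reversed factor by the factor itself.
  have h1 := M.reversal_sub_mem N (B.d_cup_eq_zero h ha hb)
  rw [reversal_cup] at h1
  have h2 := B.flip.cup_mem_of_left (N := N) (by omega) (L.reversal_sub_mem q hb) ha
  have ha' : K.d (p + 1) (K.reversal (p + 1) a) = 0 := by rw [← reversal_d, ha, map_zero]
  have hb' : L.d (q + 1) (L.reversal (q + 1) b) = 0 := by rw [← reversal_d, hb, map_zero]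
  have h3 := B.flip.cup_mem_of_right (N := N) (by omega) hb' (K.reversal_sub_mem p ha)
  have h4 := sub_mem (zsmul_mem (add_mem h2 h3) ((-1 : ℤ) ^ (p * q))) h1
  convert h4 using 1
  simp only [map_sub, LinearMap.sub_apply]
  module

end Pairing

/-- The tensor product of two systems. -/
@[reducible] def tensor (K L : SymModule.{w} k) : SymModule.{w} k where
  obj n := TensorProduct k (K.obj n) (L.obj n)
  map f := TensorProduct.map (K.map f) (L.map f)
  map_id x := by
    induction x with
    | zero => simp
    | tmul a b => simp [K.map_id, L.map_id]
    | add a b ha hb => rw [map_add, ha, hb]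
  map_map g f x := by
    induction x with
    | zero => simp
    | tmul a b => simp [K.map_map, L.map_map]
    | add a b ha hb => rw [map_add, map_add, ha, hb, map_add]

/-- The universal pairing. -/
def tensorPairing (K L : SymModule.{w} k) : Pairing K L (tensor K L) where
  app n := TensorProduct.mk k (K.obj n) (L.obj n)
  map_app _ _ _ := TensorProduct.map_tmul _ _ _ _

/-- Natural trilinear maps, as pairings on a tensor product. -/
def Pairing.ofTrilinear {K L P M : SymModule.{w} k}
    (T : ∀ n, K.obj n →ₗ[k] L.obj n →ₗ[k] P.obj n →ₗ[k] M.obj n)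
    (hT : ∀ {m n : ℕ} (f : Fin m → Fin n) (x : K.obj m) (y : L.obj m) (z : P.obj m),
      M.map f (T m x y z) = T n (K.map f x) (L.map f y) (P.map f z)) :
    Pairing (tensor K L) P M where
  app n := TensorProduct.lift (T n)
  map_app {m n} f x z := by
    induction x using TensorProduct.induction_on with
    | zero => simp only [map_zero, LinearMap.zero_apply]
    | tmul a b => exact hT f a b z
    | add a b ha hb => simp only [map_add, LinearMap.add_apply, ha, hb]

/-- Interchanging the first two arguments in a trilinear cup product of cocycles. -/
lemma trilinear_cup_sub_mem {K L P M : SymModule.{w} k}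
    (T : ∀ n, K.obj n →ₗ[k] L.obj n →ₗ[k] P.obj n →ₗ[k] M.obj n)
    (hT : ∀ {m n : ℕ} (f : Fin m → Fin n) (x : K.obj m) (y : L.obj m) (z : P.obj m),
      M.map f (T m x y z) = T n (K.map f x) (L.map f y) (P.map f z))
    {p q r N : ℕ} (h : p + q + r = N) {a : K.obj (p + 1)} {b : L.obj (q + 1)} {c : P.obj (r + 1)}
    (ha : K.d (p + 1) a = 0) (hb : L.d (q + 1) b = 0) (hc : P.d (r + 1) c = 0) :
    T (N + 1) (K.map (front (by omega)) a) (L.map (interval p (by omega)) b)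
        (P.map (interval (p + q) (by omega)) c)
      - ((-1 : ℤ) ^ (p * q)) • T (N + 1) (K.map (interval q (by omega)) a)
        (L.map (front (by omega)) b) (P.map (interval (p + q) (by omega)) c)
      ∈ M.coboundaries N := by
  -- The universal pairing and its flip take values in the same tensor product, so the interchange
  -- of `a` and `b` happens there; the resulting coboundary stays one after the cup product with
  -- `c`.
  have h1 := (tensorPairing K L).cup_sub_flip_cup_mem rfl ha hb
  have h2 := (Pairing.ofTrilinear T hT).cup_mem_of_left h h1 hc
  rw [map_sub, LinearMap.sub_apply, map_zsmul, LinearMap.smul_apply] at h2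
  refine (congrArg₂ (fun x y => x - ((-1 : ℤ) ^ (p * q)) • y ∈ M.coboundaries N) ?_ ?_).mpr h2
  · change _ = T (N + 1) (K.map _ (K.map _ a)) (L.map _ (L.map _ b)) _
    rw [K.map_map, L.map_map]
    rfl
  · change _ = T (N + 1) (K.map _ (K.map _ a)) (L.map _ (L.map _ b)) _
    rw [K.map_map, L.map_map]
    rfl

end SymModule

/-! ### Borcherds identities as finite sums. -/

/-- Truncation turns the infinite sums into sums over any sufficiently long range, which additive
maps and passage to components preserve without a condition on supports. -/
lemma finsum_eq_sum_range {A : Type*} [AddCommMonoid A] (f : ℕ → A) {N M : ℕ}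
    (hf : ∀ j, N ≤ j → f j = 0) (hM : N ≤ M) : ∑ᶠ j, f j = ∑ j ∈ Finset.range M, f j := by
  refine finsum_eq_sum_of_support_subset _ fun j hj => ?_
  by_contra h
  exact hj (hf j (by simp at h; omega))

lemma Int.negOnePow_natCast_smul {A : Type*} [AddCommGroup A] (n : ℕ) (x : A) :
    (n : ℤ).negOnePow • x = ((-1 : ℤ) ^ n) • x := by
  rw [Units.smul_def, Int.coe_negOnePow_natCast]

/-- The Borcherds identities in a vertex algebra, as identities of sufficiently long sums. -/
lemma VertexAlgebra.borcherds_sum {k V : Type*} [Field k] [AddCommGroup V] [Module k V]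
    (S : VertexAlgebra k V) (p q r : ℤ) (a b c : V) : ∃ N : ℕ, ∀ M, N ≤ M →
    ∑ j ∈ Finset.range M, Ring.choose p j •
        ((j : ℤ).negOnePow • S.prod (p + q - j) a (S.prod (r + j) b c)
          - ((j : ℤ) + p).negOnePow • S.prod (r + p - j) b (S.prod (q + j) a c))
      = ∑ j ∈ Finset.range M, Ring.choose q j • S.prod (q + r - j) (S.prod (p + j) a b) c := by
  obtain ⟨N₁, h₁⟩ := S.truncation b c
  obtain ⟨N₂, h₂⟩ := S.truncation a c
  obtain ⟨N₃, h₃⟩ := S.truncation a b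
  -- From these bounds on, the inner products `b_(r+j) c`, `a_(q+j) c` and `a_(p+j) b` vanish.
  refine ⟨max (N₁ - r).toNat (max (N₂ - q).toNat (N₃ - p).toNat), fun M hM => ?_⟩
  have := S.borcherds p q r a b c
  rwa [finsum_eq_sum_range _ (fun j hj => ?_) hM, finsum_eq_sum_range _ (fun j hj => ?_) hM] at this
  · rw [h₃ _ (by omega)]; simp
  · rw [h₁ _ (by omega), h₂ _ (by omega)]; simp

/-- A graded vertex algebra from the Borcherds identities as identities of sufficiently long
sums. -/
def GradedVertexAlgebra.ofSum {k : Type*} [Field k] {H : ℕ → Type*}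
    [∀ i, AddCommGroup (H i)] [∀ i, Module k (H i)] (vac : H 0)
    (prod : ℤ → ∀ {i j : ℕ}, H i →ₗ[k] H j →ₗ[k] H (i + j))
    (truncation : ∀ {i j : ℕ} (a : H i) (b : H j), ∃ N : ℤ, ∀ n : ℤ, N ≤ n → prod n a b = 0)
    (vac_prod : ∀ (n : ℤ) {i : ℕ} (a : H i),
      DirectSum.of H _ (prod n vac a) = if n = -1 then DirectSum.of H _ a else 0)
    (prod_vac : ∀ {i : ℕ} (a : H i), DirectSum.of H _ (prod (-1) a vac) = DirectSum.of H _ a)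
    (prod_vac_of_nonneg : ∀ (n : ℤ) {i : ℕ} (a : H i), 0 ≤ n → prod n a vac = 0)
    (borcherds : ∀ (p q r : ℤ) {α β γ : ℕ} (a : H α) (b : H β) (c : H γ),
      ∃ N : ℕ, ∀ M, N ≤ M →
      ∑ j ∈ Finset.range M, Ring.choose p j •
          ((j : ℤ).negOnePow • DirectSum.of H _ (prod (p + q - j) a (prod (r + j) b c))
            - ((j : ℤ) + p + α * β).negOnePow •
                DirectSum.of H _ (prod (r + p - j) b (prod (q + j) a c)))
        = ∑ j ∈ Finset.range M, Ring.choose q j •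
            DirectSum.of H _ (prod (q + r - j) (prod (p + j) a b) c)) :
    GradedVertexAlgebra k H where
  vac := vac
  prod := prod
  truncation := truncation
  vac_prod := vac_prod
  prod_vac := prod_vac
  prod_vac_of_nonneg := prod_vac_of_nonneg
  borcherds p q r α β γ a b c := by
    obtain ⟨N₁, h₁⟩ := truncation b c
    obtain ⟨N₂, h₂⟩ := truncation a c
    obtain ⟨N₃, h₃⟩ := truncation a b
    obtain ⟨N, h⟩ := borcherds p q r a b c
    have h := h (max N (max (N₁ - r).toNat (max (N₂ - q).toNat (N₃ - p).toNat))) (by omega)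
    rwa [← finsum_eq_sum_range (N := (max (N₁ - r).toNat (N₂ - q).toNat)) _
        (fun j hj => ?_) (by omega), ← finsum_eq_sum_range (N := (N₃ - p).toNat) _
        (fun j hj => ?_) (by omega)] at h
    · rw [h₃ _ (by omega)]; simp
    · rw [h₁ _ (by omega), h₂ _ (by omega)]; simp

/-! ### The graded vertex algebra on the cohomology of a system. -/

namespace SymModule

variable {k : Type t} [Field k]

/-- Vacuum vectors and products on a system, subject to the vacuum axioms. -/
structure Products (K : SymModule.{w} k) where
  /-- The vacuum vectors. -/
  vac : ∀ n, K.obj n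
  map_vac : ∀ {m n : ℕ} (f : Fin m → Fin n), K.map f (vac m) = vac n
  /-- The products. -/
  prod : ℤ → Pairing K K K
  vac_prod : ∀ (n : ℤ) {m : ℕ} (a : K.obj m),
    (prod n).app m (vac m) a = if n = -1 then a else 0
  prod_vac : ∀ {m : ℕ} (a : K.obj m), (prod (-1)).app m a (vac m) = a
  prod_vac_of_nonneg : ∀ (n : ℤ) {m : ℕ} (a : K.obj m), 0 ≤ n → (prod n).app m a (vac m) = 0

/-- The truncation axiom and the Borcherds identities. -/
structure Products.IsVertexAlgebra {K : SymModule.{w} k} (S : K.Products) : Prop where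
  truncation : ∀ {m : ℕ} (a b : K.obj m), ∃ N : ℤ, ∀ n : ℤ, N ≤ n → (S.prod n).app m a b = 0
  borcherds : ∀ (p q r : ℤ) {m : ℕ} (a b c : K.obj m), ∃ N : ℕ, ∀ M, N ≤ M →
    ∑ j ∈ Finset.range M, Ring.choose p j •
        ((j : ℤ).negOnePow • (S.prod (p + q - j)).app m a ((S.prod (r + j)).app m b c)
          - ((j : ℤ) + p).negOnePow • (S.prod (r + p - j)).app m b ((S.prod (q + j)).app m a c))
      = ∑ j ∈ Finset.range M,
          Ring.choose q j • (S.prod (q + r - j)).app m ((S.prod (p + j)).app m a b) c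

/-- The cocycles of degree `p`. -/
abbrev Z (K : SymModule.{w} k) (p : ℕ) : Submodule k (K.obj (p + 1)) := LinearMap.ker (K.d (p + 1))

/-- The cup product of cocycles. -/
def Pairing.cupZ {K L M : SymModule.{w} k} (B : Pairing K L M) {p q N : ℕ} (h : p + q = N)
    (a : K.Z p) (b : L.Z q) : M.Z N :=
  ⟨B.cup h a.1 b.1, B.d_cup_eq_zero h a.2 b.2⟩

/-- A presentation of the modules `H p` as the cohomology of the system `K`. -/
structure Cohomology (K : SymModule.{w} k) (H : ℕ → Type*) [∀ p, AddCommGroup (H p)]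
    [∀ p, Module k (H p)] where
  /-- The class of a cocycle. -/
  cls : ∀ p, K.Z p →ₗ[k] H p
  surjective : ∀ p, Function.Surjective (cls p)
  cls_eq_zero : ∀ {p} (x : K.Z p), x.1 ∈ K.coboundaries p → cls p x = 0
  mem_of_cls_eq_zero : ∀ {p} (x : K.Z p), cls p x = 0 → x.1 ∈ K.coboundaries p

namespace Cohomology

variable {K : SymModule.{w} k} {H : ℕ → Type*} [∀ p, AddCommGroup (H p)] [∀ p, Module k (H p)]
  (D : K.Cohomology H)

lemma cls_eq {p : ℕ} {x y : K.Z p} (h : x.1 - y.1 ∈ K.coboundaries p) :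
    D.cls p x = D.cls p y := by
  rw [← sub_eq_zero, ← map_sub]
  exact D.cls_eq_zero _ h

lemma sub_mem {p : ℕ} {x y : K.Z p} (h : D.cls p x = D.cls p y) :
    x.1 - y.1 ∈ K.coboundaries p := by
  rw [← sub_eq_zero, ← map_sub] at h
  exact D.mem_of_cls_eq_zero _ h

lemma cls_cupZ_congr (B : Pairing K K K) {p q N : ℕ} (h : p + q = N) {a a' : K.Z p} {b b' : K.Z q}
    (ha : D.cls p a = D.cls p a') (hb : D.cls q b = D.cls q b') :
    D.cls N (B.cupZ h a b) = D.cls N (B.cupZ h a' b') := by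
  apply D.cls_eq
  have h1 := B.cup_mem_of_left h (D.sub_mem ha) b.2
  have h2 := B.cup_mem_of_right h a'.2 (D.sub_mem hb)
  convert add_mem h1 h2 using 1
  simp [Pairing.cupZ]

/-- The product on cohomology induced by a pairing. -/
noncomputable def prod (B : Pairing K K K) {p q : ℕ} : H p →ₗ[k] H q →ₗ[k] H (p + q) :=
  LinearMap.mk₂ k
    -- Representatives are chosen; by `cls_cupZ_congr` the class does not depend on them, and this
    -- is what makes the product bilinear.
    (fun x y => D.cls (p + q) (B.cupZ rfl (Function.surjInv (D.surjective p) x)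
      (Function.surjInv (D.surjective q) y)))
    (fun x x' y => by
      rw [← map_add]
      refine (D.cls_cupZ_congr B rfl (a' := Function.surjInv (D.surjective p) x
        + Function.surjInv (D.surjective p) x') ?_ rfl).trans ?_
      · simp [Function.surjInv_eq]
      · congr 1; ext; simp [Pairing.cupZ])
    (fun c x y => by
      rw [← map_smul]
      refine (D.cls_cupZ_congr B rfl (a' := c • Function.surjInv (D.surjective p) x) ?_ rfl).trans ?_
      · simp [Function.surjInv_eq]
      · congr 1; ext; simp [Pairing.cupZ])
    (fun x y y' => by
      rw [← map_add]
      refine (D.cls_cupZ_congr B rfl rfl (b' := Function.surjInv (D.surjective q) y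
        + Function.surjInv (D.surjective q) y') ?_).trans ?_
      · simp [Function.surjInv_eq]
      · congr 1; ext; simp [Pairing.cupZ])
    (fun c x y => by
      rw [← map_smul]
      refine (D.cls_cupZ_congr B rfl rfl (b' := c • Function.surjInv (D.surjective q) y) ?_).trans ?_
      · simp [Function.surjInv_eq]
      · congr 1; ext; simp [Pairing.cupZ])

lemma prod_cls (B : Pairing K K K) {p q : ℕ} (a : K.Z p) (b : K.Z q) :
    D.prod B (D.cls p a) (D.cls q b) = D.cls (p + q) (B.cupZ rfl a b) :=
  D.cls_cupZ_congr B rfl (Function.surjInv_eq _ _) (Function.surjInv_eq _ _)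

/-- The free total degree `N` makes classes of degrees such as `α + (β + γ)` and `β + (α + γ)`
comparable in one module. -/
lemma of_prod_cls (B : Pairing K K K) {p q N : ℕ} (h : p + q = N) (a : K.Z p) (b : K.Z q) :
    DirectSum.of H (p + q) (D.prod B (D.cls p a) (D.cls q b))
      = DirectSum.of H N (D.cls N (B.cupZ h a b)) := by
  subst h; rw [prod_cls]

/-- The vacuum vector as a cocycle. -/
def vacZ (S : K.Products) : K.Z 0 :=
  ⟨S.vac 1, by
    rw [LinearMap.mem_ker, d_apply]
    simp [S.map_vac, Finset.sum_range_succ]⟩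

lemma of_prod_vac_left (S : K.Products) (n : ℤ) {i : ℕ} (x : H i) :
    DirectSum.of H _ (D.prod (S.prod n) (D.cls 0 (vacZ S)) x)
      = if n = -1 then DirectSum.of H _ x else 0 := by
  obtain ⟨a, rfl⟩ := D.surjective i x
  rw [D.of_prod_cls _ (zero_add i)]
  have : ((S.prod n).cupZ (zero_add i) (vacZ S) a) = if n = -1 then a else 0 := by
    apply Subtype.ext
    change (S.prod n).app (i + 1) (K.map _ (S.vac 1)) (K.map _ a.1) = _
    rw [S.map_vac, S.vac_prod]
    have : (interval 0 (by omega) : Fin (i + 1) → Fin (i + 1)) = id := by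
      ext l; simp [interval]
    rw [this, K.map_id]
    split_ifs <;> rfl
  rw [this]
  split_ifs <;> simp

lemma prod_vac_right_aux (S : K.Products) (n : ℤ) {i : ℕ} (a : K.Z i) :
    ((S.prod n).cupZ (add_zero i) a (vacZ S)).1 = (S.prod n).app (i + 1) a.1 (S.vac (i + 1)) := by
  change (S.prod n).app (i + 1) (K.map _ a.1) (K.map _ (S.vac 1)) = _
  rw [S.map_vac]
  have : (front (by omega) : Fin (i + 1) → Fin (i + 1)) = id := rfl
  rw [this, K.map_id]

lemma of_prod_vac_right (S : K.Products) {i : ℕ} (x : H i) :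
    DirectSum.of H _ (D.prod (S.prod (-1)) x (D.cls 0 (vacZ S))) = DirectSum.of H _ x := by
  obtain ⟨a, rfl⟩ := D.surjective i x
  rw [prod_cls]
  congr 2
  exact Subtype.ext ((prod_vac_right_aux S _ a).trans (S.prod_vac _))

lemma prod_vac_right_of_nonneg (S : K.Products) (n : ℤ) {i : ℕ} (x : H i) (hn : 0 ≤ n) :
    D.prod (S.prod n) x (D.cls 0 (vacZ S)) = 0 := by
  obtain ⟨a, rfl⟩ := D.surjective i x
  rw [prod_cls]
  refine D.cls_eq_zero _ ?_
  rw [show ((S.prod n).cupZ rfl a (vacZ S)).1 = 0 from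
    (prod_vac_right_aux S _ a).trans (S.prod_vac_of_nonneg _ _ hn)]
  exact zero_mem _

lemma truncation (S : K.Products) (hS : S.IsVertexAlgebra) {i j : ℕ} (x : H i) (y : H j) :
    ∃ N : ℤ, ∀ n : ℤ, N ≤ n → D.prod (S.prod n) x y = 0 := by
  obtain ⟨a, rfl⟩ := D.surjective i x
  obtain ⟨b, rfl⟩ := D.surjective j y
  obtain ⟨N, hN⟩ := hS.truncation (K.map (front (by omega)) a.1 : K.obj (i + j + 1))
    (K.map (interval i (by omega)) b.1)
  refine ⟨N, fun n hn => ?_⟩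
  rw [prod_cls]
  refine D.cls_eq_zero _ ?_
  rw [show ((S.prod n).cupZ rfl a b).1 = 0 from hN n hn]
  exact zero_mem _

lemma borcherds (S : K.Products) (hS : S.IsVertexAlgebra) (p q r : ℤ) {α β γ : ℕ}
    (x : H α) (y : H β) (z : H γ) : ∃ N : ℕ, ∀ M, N ≤ M →
    ∑ j ∈ Finset.range M, Ring.choose p j •
        ((j : ℤ).negOnePow • DirectSum.of H _
            (D.prod (S.prod (p + q - j)) x (D.prod (S.prod (r + j)) y z))
          - ((j : ℤ) + p + α * β).negOnePow • DirectSum.of H _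
              (D.prod (S.prod (r + p - j)) y (D.prod (S.prod (q + j)) x z)))
      = ∑ j ∈ Finset.range M, Ring.choose q j • DirectSum.of H _
          (D.prod (S.prod (q + r - j)) (D.prod (S.prod (p + j)) x y) z) := by
  obtain ⟨a, rfl⟩ := D.surjective α x
  obtain ⟨b, rfl⟩ := D.surjective β y
  obtain ⟨c, rfl⟩ := D.surjective γ z
  obtain ⟨n, hn⟩ : ∃ n, n = α + β + γ := ⟨_, rfl⟩
  -- The identity is used for the three cochains already restricted to consecutive blocks of the `n
  -- + 1` indices, in the order `a`, `b`, `c`.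
  obtain ⟨N, hN⟩ := hS.borcherds p q r (m := n + 1) (K.map (front (by omega)) a.1)
    (K.map (interval α (by omega)) b.1) (K.map (interval (α + β) (by omega)) c.1)
  refine ⟨N, fun M hM => ?_⟩
  have hN := hN M hM
  have eA : ∀ s t : ℤ, (((S.prod s).cupZ (N := n) (by omega) a
      ((S.prod t).cupZ rfl b c)).1 : K.obj (n + 1))
      = (S.prod s).app (n + 1) (K.map (front (by omega)) a.1) ((S.prod t).app (n + 1)
        (K.map (interval α (by omega)) b.1) (K.map (interval (α + β) (by omega)) c.1)) := by
    intro s t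
    change (S.prod s).app (n + 1) _ (K.map _ ((S.prod t).app _ _ _)) = _
    rw [Pairing.map_app, K.map_map, K.map_map, interval_comp_front, interval_comp_interval]
  have eB : ∀ s t : ℤ, (((S.prod s).cupZ (N := n) (by omega) b
      ((S.prod t).cupZ rfl a c)).1 : K.obj (n + 1))
      = (S.prod s).app (n + 1) (K.map (front (by omega)) b.1) ((S.prod t).app (n + 1)
        (K.map (interval β (by omega)) a.1) (K.map (interval (α + β) (by omega)) c.1)) := by
    intro s t
    change (S.prod s).app (n + 1) _ (K.map _ ((S.prod t).app _ _ _)) = _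
    rw [Pairing.map_app, K.map_map, K.map_map, interval_comp_front, interval_comp_interval,
      interval_congr _ (add_comm β α)]
  have eC : ∀ s t : ℤ, (((S.prod s).cupZ (N := n) (by omega) ((S.prod t).cupZ rfl a b) c).1 :
        K.obj (n + 1))
      = (S.prod s).app (n + 1) ((S.prod t).app (n + 1) (K.map (front (by omega)) a.1)
        (K.map (interval α (by omega)) b.1)) (K.map (interval (α + β) (by omega)) c.1) := by
    intro s t
    change (S.prod s).app (n + 1) (K.map _ ((S.prod t).app _ _ _)) _ = _
    rw [Pairing.map_app, K.map_map, K.map_map, front_comp_front, front_comp_interval]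
  -- By `eB` the cochain `b(ac)` has `b` in front, unlike the term in `hN`. The interchange lemma,
  -- for the trilinear map `(a, b, c) ↦ b_(s) (a_(t) c)`, supplies the sign and the coboundary.
  have comm : ∀ s t : ℤ, (S.prod s).app (n + 1) (K.map (interval α (by omega)) b.1)
        ((S.prod t).app (n + 1) (K.map (front (by omega)) a.1)
          (K.map (interval (α + β) (by omega)) c.1))
      - ((-1 : ℤ) ^ (α * β)) • ((S.prod s).cupZ (N := n) (by omega) b
          ((S.prod t).cupZ rfl a c)).1 ∈ K.coboundaries n := by
    intro s t
    rw [eB]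
    refine trilinear_cup_sub_mem (fun m => LinearMap.mk₂ k
      (fun a b => ((S.prod s).app m b).comp ((S.prod t).app m a)) ?_ ?_ ?_ ?_)
      ?_ hn.symm a.2 b.2 c.2
    · intros; ext; simp
    · intros; ext; simp
    · intros; ext; simp
    · intros; ext; simp
    · intros; simp [Pairing.map_app]
  have key : D.cls n (∑ j ∈ Finset.range M, Ring.choose p j •
        ((j : ℤ).negOnePow • (S.prod (p + q - j)).cupZ (N := n) (by omega) a
            ((S.prod (r + j)).cupZ rfl b c)
          - ((j : ℤ) + p + α * β).negOnePow • (S.prod (r + p - j)).cupZ (N := n) (by omega) b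
            ((S.prod (q + j)).cupZ rfl a c)))
      = D.cls n (∑ j ∈ Finset.range M, Ring.choose q j •
          (S.prod (q + r - j)).cupZ (N := n) (by omega) ((S.prod (p + j)).cupZ rfl a b) c) := by
    apply D.cls_eq
    simp only [AddSubgroupClass.coe_sub, Submodule.coe_sum, Submodule.coe_smul_of_tower, eA, eC]
    -- The `a(bc)` terms now cancel, and each summand is a multiple of a coboundary from `comm`.
    rw [← hN, ← Finset.sum_sub_distrib]
    refine sum_mem fun j _ => ?_
    rw [← smul_sub]
    refine zsmul_mem ?_ _
    -- The graded sign is the ungraded one times `(-1)^(α * β)`, and the latter is the sign of the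
    -- interchange.
    have h := zsmul_mem (comm (r + p - j) (q + j)) (((j : ℤ) + p).negOnePow : ℤ)
    rw [Int.negOnePow_add _ ((α : ℤ) * β), mul_smul, ← Nat.cast_mul,
      Int.negOnePow_natCast_smul (α * β)]
    convert h using 1
    simp only [Units.smul_def]
    module
  have key := congrArg (DirectSum.of H n) key
  simp only [map_sum, map_sub, map_zsmul, Units.smul_def] at key
  rw [← sub_eq_zero] at key ⊢
  refine Eq.trans ?_ key
  congr 1
  · refine Finset.sum_congr rfl fun j _ => ?_
    rw [D.prod_cls _ b c, D.prod_cls _ a c, D.of_prod_cls _ (by omega : α + (β + γ) = n),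
      D.of_prod_cls _ (by omega : β + (α + γ) = n), Units.smul_def, Units.smul_def]
  · refine Finset.sum_congr rfl fun j _ => ?_
    rw [D.prod_cls _ a b, D.of_prod_cls _ hn.symm]

/-- The graded vertex algebra structure on cohomology. -/
noncomputable def gradedVertexAlgebra (S : K.Products) (hS : S.IsVertexAlgebra) :
    GradedVertexAlgebra k H :=
  .ofSum (D.cls 0 (vacZ S)) (fun n _ _ => D.prod (S.prod n)) (D.truncation S hS)
    (D.of_prod_vac_left S) (D.of_prod_vac_right S) (D.prod_vac_right_of_nonneg S)
    (D.borcherds S hS)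

end Cohomology

end SymModule

/-! ### Čech cochains as a symmetric cosimplicial module. -/

lemma ModuleCat.sum_zsmul_apply {k : Type t} [Ring k] {M N : ModuleCat.{w} k} {ι : Type*}
    (s : Finset ι) (n : ι → ℤ) (f : ι → (M ⟶ N)) (x : M) :
    (∑ j ∈ s, n j • f j).hom x = ∑ j ∈ s, n j • (f j).hom x := by
  simp [ModuleCat.hom_sum]

namespace VertexAlgebraSheaf

variable {C : Type u} [Category.{v} C] [HasFiniteProducts C] {J : GrothendieckTopology C}
  {k : Type t} [Field k]

lemma restrict_id (𝒱 : VertexAlgebraSheaf.{w} J k) (𝒰 : FormalCoproduct.{w} C) {n : ℕ}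
    (i : Fin n → 𝒰.I) (x : 𝒱.sheaf.obj.obj (op (∏ᶜ fun l => 𝒰.obj (i l)))) :
    𝒱.restrict 𝒰 id i x = x := by
  have : (Pi.lift fun l => Pi.π (fun l => 𝒰.obj (i l)) (id l)) = 𝟙 _ := by
    apply Pi.hom_ext; intro l; simp
  simp only [restrict]
  erw [this, op_id, 𝒱.sheaf.obj.map_id]
  rfl

lemma restrict_restrict (𝒱 : VertexAlgebraSheaf.{w} J k) (𝒰 : FormalCoproduct.{w} C) {l m n : ℕ}
    (g : Fin m → Fin n) (f : Fin l → Fin m) (i : Fin n → 𝒰.I)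
    (x : 𝒱.sheaf.obj.obj (op (∏ᶜ fun j => 𝒰.obj (i (g (f j)))))) :
    𝒱.restrict 𝒰 g i (𝒱.restrict 𝒰 f (fun j => i (g j)) x) = 𝒱.restrict 𝒰 (g ∘ f) i x := by
  have : (Pi.lift fun l => Pi.π (fun l => 𝒰.obj (i l)) (g l)) ≫
      (Pi.lift fun l => Pi.π (fun j => 𝒰.obj (i (g j))) (f l))
      = (Pi.lift fun l => Pi.π (fun l => 𝒰.obj (i l)) ((g ∘ f) l)) := by
    apply Pi.hom_ext; intro l; simp
  simp only [restrict]
  rw [← this, op_comp, 𝒱.sheaf.obj.map_comp]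
  rfl

/-- The Čech cochains of a family, as a functor of finite sets. -/
@[reducible] noncomputable def cechSystem (𝒱 : VertexAlgebraSheaf.{w} J k) (𝒰 : FormalCoproduct.{w} C) :
    SymModule.{w} k where
  obj n := ∀ i : Fin n → 𝒰.I, 𝒱.sheaf.obj.obj (op (∏ᶜ fun l => 𝒰.obj (i l)))
  map f := LinearMap.pi fun i => 𝒱.restrict 𝒰 f i ∘ₗ LinearMap.proj (fun l => i (f l))
  map_id x := by ext i; exact 𝒱.restrict_id 𝒰 i (x i)
  map_map g f x := by ext i; exact 𝒱.restrict_restrict 𝒰 g f i _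

/-- The products of Čech cochains. -/
noncomputable def cechProducts (𝒱 : VertexAlgebraSheaf.{w} J k) (𝒰 : FormalCoproduct.{w} C) :
    (𝒱.cechSystem 𝒰).Products where
  vac _ _ := (𝒱.str _).vac
  map_vac f := by ext i; exact 𝒱.map_vac _
  prod n :=
    { app := fun m => LinearMap.mk₂ k (fun a b i => (𝒱.str _).prod n (a i) (b i))
        (fun _ _ _ => by ext; simp) (fun _ _ _ => by ext; simp)
        (fun _ _ _ => by ext; simp) (fun _ _ _ => by ext; simp)
      map_app := fun f x y => by ext i; exact 𝒱.map_prod _ _ _ _ }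
  vac_prod n m a := by
    ext i
    refine ((𝒱.str _).vac_prod n (a i)).trans ?_
    split_ifs <;> rfl
  prod_vac a := by ext i; exact (𝒱.str _).prod_vac (a i)
  prod_vac_of_nonneg n m a hn := by ext i; exact (𝒱.str _).prod_vac_of_nonneg n (a i) hn

/-- The bounds depend on the index tuple. A finite family has finitely many tuples of each length,
so a common bound exists; this is how finiteness enters the axioms. -/
lemma cechProducts_isVertexAlgebra (𝒱 : VertexAlgebraSheaf.{w} J k) (𝒰 : FormalCoproduct.{w} C)
    [Finite 𝒰.I] : (𝒱.cechProducts 𝒰).IsVertexAlgebra where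
  truncation {m} a b := by
    choose N hN using fun i => (𝒱.str _).truncation (a i) (b i)
    obtain ⟨M, hM⟩ := Set.finite_range N |>.bddAbove
    exact ⟨M, fun n hn => funext fun i => hN i n ((hM ⟨i, rfl⟩).trans hn)⟩
  borcherds p q r {m} a b c := by
    choose N hN using fun i => (𝒱.str _).borcherds_sum p q r (a i) (b i) (c i)
    obtain ⟨M, hM⟩ := Set.finite_range N |>.bddAbove
    refine ⟨M, fun n hn => funext fun i => ?_⟩
    have := hN i n ((hM ⟨i, rfl⟩).trans hn)
    rw [Finset.sum_apply, Finset.sum_apply]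
    exact this

/-- The map of Čech cochains induced by a refinement map. -/
noncomputable def cechHom (𝒱 : VertexAlgebraSheaf.{w} J k) {𝒰 𝒰' : FormalCoproduct.{w} C}
    (φ : 𝒰' ⟶ 𝒰) : SymModule.Hom (𝒱.cechSystem 𝒰) (𝒱.cechSystem 𝒰') where
  app n := LinearMap.pi fun i =>
    (𝒱.sheaf.obj.map (Limits.Pi.map fun l => φ.φ (i l)).op).hom ∘ₗ LinearMap.proj (fun l => φ.f (i l))
  app_map {m n} f x := by
    ext i
    change 𝒱.sheaf.obj.map (Limits.Pi.map fun l => φ.φ (i l)).op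
      (𝒱.sheaf.obj.map (Pi.lift fun l => Pi.π (fun l => 𝒰.obj (φ.f (i l))) (f l)).op _)
      = 𝒱.sheaf.obj.map (Pi.lift fun l => Pi.π (fun l => 𝒰'.obj (i l)) (f l)).op
        (𝒱.sheaf.obj.map (Limits.Pi.map fun l => φ.φ (i (f l))).op _)
    have e : (Pi.lift fun l => Pi.π (fun l => 𝒰'.obj (i l)) (f l)) ≫
          (Limits.Pi.map fun l => φ.φ (i (f l)))
        = (Limits.Pi.map fun l => φ.φ (i l)) ≫
          (Pi.lift fun l => Pi.π (fun l => 𝒰.obj (φ.f (i l))) (f l)) := by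
      apply Pi.hom_ext; intro l; simp
    rw [← ModuleCat.comp_apply, ← ModuleCat.comp_apply, ← Functor.map_comp, ← Functor.map_comp,
      ← op_comp, ← op_comp, e]

lemma cechHom_vac (𝒱 : VertexAlgebraSheaf.{w} J k) {𝒰 𝒰' : FormalCoproduct.{w} C}
    (φ : 𝒰' ⟶ 𝒰) (n : ℕ) :
    (𝒱.cechHom φ).app n ((𝒱.cechProducts 𝒰).vac n) = (𝒱.cechProducts 𝒰').vac n := by
  ext i; exact 𝒱.map_vac _

lemma cechHom_prod (𝒱 : VertexAlgebraSheaf.{w} J k) {𝒰 𝒰' : FormalCoproduct.{w} C}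
    (φ : 𝒰' ⟶ 𝒰) (s : ℤ) (n : ℕ) (x y : (𝒱.cechSystem 𝒰).obj n) :
    (𝒱.cechHom φ).app n (((𝒱.cechProducts 𝒰).prod s).app n x y)
      = ((𝒱.cechProducts 𝒰').prod s).app n ((𝒱.cechHom φ).app n x) ((𝒱.cechHom φ).app n y) := by
  ext i; exact 𝒱.map_prod _ _ _ _

/-- Mathlib's Čech cochains as families of sections. -/
noncomputable def cochainEquiv (𝒱 : VertexAlgebraSheaf.{w} J k) (𝒰 : FormalCoproduct.{w} C)
    (p : ℕ) : (𝒱.cechComplex.obj (op 𝒰)).X p ≃ₗ[k] (𝒱.cechSystem 𝒰).obj (p + 1) :=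
  (ModuleCat.piIsoPi (fun i : Fin (p + 1) → 𝒰.I =>
    𝒱.sheaf.obj.obj (op (∏ᶜ fun l => 𝒰.obj (i l))))).toLinearEquiv

lemma cochainEquiv_apply (𝒱 : VertexAlgebraSheaf.{w} J k) (𝒰 : FormalCoproduct.{w} C)
    (p : ℕ) (x : (𝒱.cechComplex.obj (op 𝒰)).X p) (i : Fin (p + 1) → 𝒰.I) :
    𝒱.cochainEquiv 𝒰 p x i = Pi.π (fun i : Fin (p + 1) → 𝒰.I =>
      𝒱.sheaf.obj.obj (op (∏ᶜ fun l => 𝒰.obj (i l)))) i x := by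
  have := ModuleCat.piIsoPi_hom_ker_subtype (fun i : Fin (p + 1) → 𝒰.I =>
    𝒱.sheaf.obj.obj (op (∏ᶜ fun l => 𝒰.obj (i l)))) i
  exact congrArg (fun f => f.hom x) this

/-- The Čech cosimplicial module of a family. -/
noncomputable def cechCosimplicial (𝒱 : VertexAlgebraSheaf.{w} J k) :
    (FormalCoproduct.{w} C)ᵒᵖ ⥤ CosimplicialObject (ModuleCat.{w} k) :=
  FormalCoproduct.cechFunctor.op ⋙ (simplicialCosimplicialEquiv _).functor ⋙
    (CosimplicialObject.whiskering _ _).obj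
      ((FormalCoproduct.evalOp.{w} C (ModuleCat.{w} k)).obj 𝒱.sheaf.obj)

lemma cechCosimplicial_δ (𝒱 : VertexAlgebraSheaf.{w} J k) (𝒰 : FormalCoproduct.{w} C)
    (p : ℕ) (j : Fin (p + 2)) (x : ((𝒱.cechCosimplicial.obj (op 𝒰)).obj (SimplexCategory.mk p)))
    (i : Fin (p + 2) → 𝒰.I) :
    Pi.π (fun i : Fin (p + 2) → 𝒰.I =>
      𝒱.sheaf.obj.obj (op (∏ᶜ fun l => 𝒰.obj (i l)))) i
        ((𝒱.cechCosimplicial.obj (op 𝒰)).δ j x)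
      = 𝒱.restrict 𝒰 j.succAbove i (Pi.π (fun i : Fin (p + 1) → 𝒰.I =>
      𝒱.sheaf.obj.obj (op (∏ᶜ fun l => 𝒰.obj (i l)))) (fun l => i (j.succAbove l)) x) := by
  have h : (𝒱.cechCosimplicial.obj (op 𝒰)).δ j ≫ Pi.π (fun i : Fin (p + 2) → 𝒰.I =>
      𝒱.sheaf.obj.obj (op (∏ᶜ fun l => 𝒰.obj (i l)))) i
      = Pi.π (fun i : Fin (p + 1) → 𝒰.I =>
      𝒱.sheaf.obj.obj (op (∏ᶜ fun l => 𝒰.obj (i l)))) (fun l => i (j.succAbove l)) ≫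
        𝒱.sheaf.obj.map
    (Pi.lift fun l => Pi.π (fun l => 𝒰.obj (i l)) (j.succAbove l)).op := by
    -- The coface is by construction a lift into a product, so its components can be read off.
    exact limit.lift_π _ _
  exact congrArg (fun f => f.hom x) h

lemma cochainEquiv_d (𝒱 : VertexAlgebraSheaf.{w} J k) (𝒰 : FormalCoproduct.{w} C)
    (p : ℕ) (x : (𝒱.cechComplex.obj (op 𝒰)).X p) :
    𝒱.cochainEquiv 𝒰 (p + 1) ((𝒱.cechComplex.obj (op 𝒰)).d p (p + 1) x)
      = (𝒱.cechSystem 𝒰).d (p + 1) (𝒱.cochainEquiv 𝒰 p x) := by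
  have h : (𝒱.cechComplex.obj (op 𝒰)).d p (p + 1)
      = AlgebraicTopology.AlternatingCofaceMapComplex.objD (𝒱.cechCosimplicial.obj (op 𝒰)) p :=
    CochainComplex.of_d (fun n => (𝒱.cechCosimplicial.obj (op 𝒰)).obj (SimplexCategory.mk n))
      (AlgebraicTopology.AlternatingCofaceMapComplex.objD (𝒱.cechCosimplicial.obj (op 𝒰))) p
  let D : Fin (p + 2) → ((𝒱.cechComplex.obj (op 𝒰)).X p →ₗ[k]
      (𝒱.cechComplex.obj (op 𝒰)).X (p + 1)) := fun j => ((𝒱.cechCosimplicial.obj (op 𝒰)).δ j).hom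
  have hD : (𝒱.cechComplex.obj (op 𝒰)).d p (p + 1) x = ∑ j, ((-1 : ℤ) ^ j.1) • D j x :=
    (congrArg (fun f => f.hom x) h).trans (ModuleCat.sum_zsmul_apply _ _ _ _)
  have h2 : ∀ j : Fin (p + 2), 𝒱.cochainEquiv 𝒰 (p + 1) (D j x)
      = (𝒱.cechSystem 𝒰).map (SymModule.coface j) (𝒱.cochainEquiv 𝒰 p x) := by
    intro j
    have : (SymModule.coface j : Fin (p + 1) → Fin (p + 2)) = j.succAbove := by
      ext l
      simp only [SymModule.coface, Fin.succAbove, Fin.lt_def, Fin.val_castSucc]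
      split_ifs <;> rfl
    rw [this]
    ext i
    rw [cochainEquiv_apply]
    refine (𝒱.cechCosimplicial_δ 𝒰 p j x i).trans ?_
    change _ = 𝒱.restrict 𝒰 j.succAbove i (𝒱.cochainEquiv 𝒰 p x _)
    rw [cochainEquiv_apply]
  rw [hD, SymModule.d_apply, ← Fin.sum_univ_eq_sum_range
    (fun j => ((-1 : ℤ) ^ j) • (𝒱.cechSystem 𝒰).map (SymModule.coface j) (𝒱.cochainEquiv 𝒰 p x)),
    map_sum]
  exact Finset.sum_congr rfl fun j _ => (map_zsmul _ _ _).trans (congrArg _ (h2 j))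

lemma cochainEquiv_map (𝒱 : VertexAlgebraSheaf.{w} J k) {𝒰 𝒰' : FormalCoproduct.{w} C}
    (φ : 𝒰' ⟶ 𝒰) (p : ℕ) (x : (𝒱.cechComplex.obj (op 𝒰)).X p) :
    𝒱.cochainEquiv 𝒰' p ((𝒱.cechComplex.map φ.op).f p x)
      = (𝒱.cechHom φ).app (p + 1) (𝒱.cochainEquiv 𝒰 p x) := by
  ext i
  rw [cochainEquiv_apply]
  have h : (𝒱.cechComplex.map φ.op).f p ≫ Pi.π (fun i : Fin (p + 1) → 𝒰'.I =>
      𝒱.sheaf.obj.obj (op (∏ᶜ fun l => 𝒰'.obj (i l)))) i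
      = Pi.π (fun i : Fin (p + 1) → 𝒰.I =>
      𝒱.sheaf.obj.obj (op (∏ᶜ fun l => 𝒰.obj (i l)))) (fun l => φ.f (i l)) ≫
        𝒱.sheaf.obj.map (Limits.Pi.map fun l => φ.φ (i l)).op := by
    exact limit.lift_π _ _
  refine (congrArg (fun f => f.hom x) h).trans ?_
  change _ = 𝒱.sheaf.obj.map (Limits.Pi.map fun l => φ.φ (i l)).op (𝒱.cochainEquiv 𝒰 p x _)
  rw [cochainEquiv_apply]
  rfl

lemma component_eq (𝒱 : VertexAlgebraSheaf.{w} J k) (𝒰 : FormalCoproduct.{w} C) {p : ℕ}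
    (a : 𝒱.cocycles 𝒰 p) (i : Fin (p + 1) → 𝒰.I) : 𝒱.component 𝒰 a i
      = 𝒱.cochainEquiv 𝒰 p ((𝒱.cechComplex.obj (op 𝒰)).iCycles p a) i :=
  (𝒱.cochainEquiv_apply 𝒰 p _ i).symm

end VertexAlgebraSheaf

/-- In a cochain complex of modules, a cochain with vanishing differential comes from a
cocycle. -/
lemma CochainComplex.exists_iCycles_eq {k : Type t} [Ring k] (K : CochainComplex (ModuleCat.{w} k) ℕ)
    (p : ℕ) {x : K.X p} (hx : K.d p (p + 1) x = 0) : ∃ a, K.iCycles p a = x := by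
  have h := K.cyclesIsKernel p (p + 1) (by simp)
  have := ShortComplex.exact_of_f_is_kernel (ShortComplex.mk _ _ (K.iCycles_d p (p + 1))) h
  exact (ShortComplex.moduleCat_exact_iff _).1 this x hx

lemma CochainComplex.iCycles_injective {k : Type t} [Ring k]
    (K : CochainComplex (ModuleCat.{w} k) ℕ) (p : ℕ) : Function.Injective (K.iCycles p) :=
  (ModuleCat.mono_iff_injective _).1 inferInstance

lemma CochainComplex.homologyπ_surjective {k : Type t} [Ring k]
    (K : CochainComplex (ModuleCat.{w} k) ℕ) (p : ℕ) : Function.Surjective (K.homologyπ p) :=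
  (ModuleCat.epi_iff_surjective _).1 inferInstance

lemma CochainComplex.homologyπ_eq_zero_iff {k : Type t} [Ring k]
    (K : CochainComplex (ModuleCat.{w} k) ℕ) (p : ℕ) (a : K.cycles p) {j : ℕ}
    (hj : (ComplexShape.up ℕ).prev p = j) :
    K.homologyπ p a = 0 ↔ ∃ y, K.iCycles p a = K.d j p y := by
  have h := K.homologyIsCokernel j p hj
  have := ShortComplex.exact_of_g_is_cokernel
    (ShortComplex.mk _ _ (K.toCycles_comp_homologyπ j p)) h
  have h2 : ∀ y, K.iCycles p (K.toCycles j p y) = K.d j p y := fun y =>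
    congrArg (fun f => f.hom y) (K.toCycles_i j p)
  constructor
  · intro ha
    obtain ⟨y, hy⟩ := (ShortComplex.moduleCat_exact_iff _).1 this a ha
    exact ⟨y, by rw [← h2, ← hy]⟩
  · rintro ⟨y, hy⟩
    rw [← h2] at hy
    rw [K.iCycles_injective p hy]
    exact congrArg (fun f => f.hom y) (K.toCycles_comp_homologyπ j p)

/-! ### Čech cohomology of a family and its functoriality. -/

namespace VertexAlgebraSheaf

variable {C : Type u} [Category.{v} C] [HasFiniteProducts C] {J : GrothendieckTopology C}
  {k : Type t} [Field k]

/-- The cocycles in Mathlib's Čech complex are the families of sections with vanishing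
differential. -/
noncomputable def cocycleEquiv (𝒱 : VertexAlgebraSheaf.{w} J k) (𝒰 : FormalCoproduct.{w} C)
    (p : ℕ) : 𝒱.cocycles 𝒰 p ≃ₗ[k] (𝒱.cechSystem 𝒰).Z p :=
  LinearEquiv.ofBijective
    (LinearMap.codRestrict _
      ((𝒱.cochainEquiv 𝒰 p).toLinearMap ∘ₗ ((𝒱.cechComplex.obj (op 𝒰)).iCycles p).hom)
      fun a => by
        have h : (𝒱.cechComplex.obj (op 𝒰)).d p (p + 1)
            ((𝒱.cechComplex.obj (op 𝒰)).iCycles p a) = 0 :=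
          congrArg (fun f => f.hom a) ((𝒱.cechComplex.obj (op 𝒰)).iCycles_d p (p + 1))
        have h2 := 𝒱.cochainEquiv_d 𝒰 p ((𝒱.cechComplex.obj (op 𝒰)).iCycles p a)
        rw [h, map_zero] at h2
        exact h2.symm)
    ⟨fun a b h => CochainComplex.iCycles_injective _ p
        ((𝒱.cochainEquiv 𝒰 p).injective (congrArg Subtype.val h)),
      fun x => by
        obtain ⟨a, ha⟩ := (𝒱.cechComplex.obj (op 𝒰)).exists_iCycles_eq p
          (x := (𝒱.cochainEquiv 𝒰 p).symm x.1) (by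
            apply (𝒱.cochainEquiv 𝒰 (p + 1)).injective
            rw [cochainEquiv_d, LinearEquiv.apply_symm_apply, map_zero]
            exact x.2)
        refine ⟨a, Subtype.ext ?_⟩
        change 𝒱.cochainEquiv 𝒰 p ((𝒱.cechComplex.obj (op 𝒰)).iCycles p a) = x.1
        rw [ha, LinearEquiv.apply_symm_apply]⟩

lemma cocycleEquiv_apply (𝒱 : VertexAlgebraSheaf.{w} J k) (𝒰 : FormalCoproduct.{w} C)
    {p : ℕ} (a : 𝒱.cocycles 𝒰 p) : (𝒱.cocycleEquiv 𝒰 p a).1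
      = 𝒱.cochainEquiv 𝒰 p ((𝒱.cechComplex.obj (op 𝒰)).iCycles p a) := rfl

lemma component_eq_cocycleEquiv (𝒱 : VertexAlgebraSheaf.{w} J k) (𝒰 : FormalCoproduct.{w} C)
    {p : ℕ} (a : 𝒱.cocycles 𝒰 p) (i : Fin (p + 1) → 𝒰.I) :
    𝒱.component 𝒰 a i = (𝒱.cocycleEquiv 𝒰 p a).1 i := 𝒱.component_eq 𝒰 a i

lemma cocycleClass_eq_zero_iff (𝒱 : VertexAlgebraSheaf.{w} J k) (𝒰 : FormalCoproduct.{w} C)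
    {p : ℕ} (a : 𝒱.cocycles 𝒰 p) : 𝒱.cocycleClass 𝒰 p a = 0 ↔
      (𝒱.cocycleEquiv 𝒰 p a).1 ∈ (𝒱.cechSystem 𝒰).coboundaries p := by
  rw [cocycleEquiv_apply]
  cases p with
  | zero =>
    -- The predecessor of `0` is `0` by convention and `d 0 0 = 0`, so only the zero cocycle is a
    -- coboundary.
    refine (CochainComplex.homologyπ_eq_zero_iff _ 0 a (j := 0) (by simp)).trans ?_
    simp only [SymModule.coboundaries, Submodule.mem_bot, LinearEquiv.map_eq_zero_iff]
    constructor
    · rintro ⟨y, hy⟩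
      rw [hy, HomologicalComplex.shape _ _ _ (by simp)]
      rfl
    · intro h
      exact ⟨0, by rw [h, map_zero]⟩
  | succ p =>
    refine (CochainComplex.homologyπ_eq_zero_iff _ (p + 1) a (j := p) (by simp)).trans ?_
    constructor
    · rintro ⟨y, hy⟩
      exact ⟨𝒱.cochainEquiv 𝒰 p y, by rw [hy, cochainEquiv_d]⟩
    · rintro ⟨y, hy⟩
      refine ⟨(𝒱.cochainEquiv 𝒰 p).symm y, ?_⟩
      apply (𝒱.cochainEquiv 𝒰 (p + 1)).injective
      rw [cochainEquiv_d, LinearEquiv.apply_symm_apply, hy]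

/-- The Čech cohomology of a family is the cohomology of the system of its Čech cochains. -/
noncomputable def cechCohomology (𝒱 : VertexAlgebraSheaf.{w} J k) (𝒰 : FormalCoproduct.{w} C) :
    (𝒱.cechSystem 𝒰).Cohomology (fun p => 𝒱.familyCohomology 𝒰 p) where
  cls p := 𝒱.cocycleClass 𝒰 p ∘ₗ (𝒱.cocycleEquiv 𝒰 p).symm.toLinearMap
  surjective p := (CochainComplex.homologyπ_surjective _ p).comp (𝒱.cocycleEquiv 𝒰 p).symm.surjective
  cls_eq_zero {p} x hx := by
    refine (𝒱.cocycleClass_eq_zero_iff 𝒰 _).2 ?_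
    simpa using hx
  mem_of_cls_eq_zero {p} x hx := by
    simpa using (𝒱.cocycleClass_eq_zero_iff 𝒰 ((𝒱.cocycleEquiv 𝒰 p).symm x)).1 hx

lemma cls_cocycleEquiv (𝒱 : VertexAlgebraSheaf.{w} J k) (𝒰 : FormalCoproduct.{w} C) {p : ℕ}
    (a : 𝒱.cocycles 𝒰 p) : (𝒱.cechCohomology 𝒰).cls p (𝒱.cocycleEquiv 𝒰 p a)
      = 𝒱.cocycleClass 𝒰 p a := by
  simp [cechCohomology]

/-- The class of the family of the vacuum vectors. -/
noncomputable def vacClass (𝒱 : VertexAlgebraSheaf.{w} J k) (𝒰 : FormalCoproduct.{w} C) :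
    𝒱.familyCohomology 𝒰 0 :=
  (𝒱.cechCohomology 𝒰).cls 0 (SymModule.Cohomology.vacZ (𝒱.cechProducts 𝒰))

/-- The products on the Čech cohomology of a family. -/
noncomputable def cohomologyProd (𝒱 : VertexAlgebraSheaf.{w} J k) (𝒰 : FormalCoproduct.{w} C)
    (n : ℤ) {p q : ℕ} : 𝒱.familyCohomology 𝒰 p →ₗ[k] 𝒱.familyCohomology 𝒰 q →ₗ[k]
      𝒱.familyCohomology 𝒰 (p + q) :=
  (𝒱.cechCohomology 𝒰).prod ((𝒱.cechProducts 𝒰).prod n)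

lemma exists_isVacuum (𝒱 : VertexAlgebraSheaf.{w} J k) (𝒰 : FormalCoproduct.{w} C) :
    ∃ e : 𝒱.cocycles 𝒰 0, 𝒱.IsVacuum 𝒰 e ∧ 𝒱.vacClass 𝒰 = 𝒱.cocycleClass 𝒰 0 e := by
  refine ⟨(𝒱.cocycleEquiv 𝒰 0).symm (SymModule.Cohomology.vacZ (𝒱.cechProducts 𝒰)),
    fun i => ?_, rfl⟩
  rw [component_eq_cocycleEquiv, LinearEquiv.apply_symm_apply]
  rfl

lemma exists_isCupProduct (𝒱 : VertexAlgebraSheaf.{w} J k) (𝒰 : FormalCoproduct.{w} C)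
    (n : ℤ) {p q : ℕ} (a : 𝒱.cocycles 𝒰 p) (b : 𝒱.cocycles 𝒰 q) :
    ∃ c : 𝒱.cocycles 𝒰 (p + q), 𝒱.IsCupProduct 𝒰 n a b c ∧
      𝒱.cohomologyProd 𝒰 n (𝒱.cocycleClass 𝒰 p a) (𝒱.cocycleClass 𝒰 q b)
        = 𝒱.cocycleClass 𝒰 (p + q) c := by
  refine ⟨(𝒱.cocycleEquiv 𝒰 (p + q)).symm (((𝒱.cechProducts 𝒰).prod n).cupZ rfl
    (𝒱.cocycleEquiv 𝒰 p a) (𝒱.cocycleEquiv 𝒰 q b)), fun i => ?_, ?_⟩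
  · simp only [component_eq_cocycleEquiv]
    rw [LinearEquiv.apply_symm_apply]
    rfl
  · rw [← cls_cocycleEquiv, ← cls_cocycleEquiv]
    exact (𝒱.cechCohomology 𝒰).prod_cls _ _ _

lemma cocycleEquiv_map (𝒱 : VertexAlgebraSheaf.{w} J k) {𝒰 𝒰' : FormalCoproduct.{w} C}
    (φ : 𝒰' ⟶ 𝒰) {p : ℕ} (a : 𝒱.cocycles 𝒰 p) :
    (𝒱.cocycleEquiv 𝒰' p (HomologicalComplex.cyclesMap (𝒱.cechComplex.map φ.op) p a)).1
      = (𝒱.cechHom φ).app (p + 1) (𝒱.cocycleEquiv 𝒰 p a).1 := by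
  rw [cocycleEquiv_apply, cocycleEquiv_apply, ← cochainEquiv_map]
  congr 1
  exact congrArg (fun f => f.hom a) (HomologicalComplex.cyclesMap_i (𝒱.cechComplex.map φ.op) p)

/-- Reduces the compatibility of refinement maps with the vacuum and the products to equalities of
cochains. -/
lemma map_cls (𝒱 : VertexAlgebraSheaf.{w} J k) {𝒰 𝒰' : FormalCoproduct.{w} C}
    (φ : 𝒰' ⟶ 𝒰) {p : ℕ} (x : (𝒱.cechSystem 𝒰).Z p) (y : (𝒱.cechSystem 𝒰').Z p)
    (h : (𝒱.cechHom φ).app (p + 1) x.1 = y.1) :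
    (𝒱.cechFunctor p).map φ.op ((𝒱.cechCohomology 𝒰).cls p x) = (𝒱.cechCohomology 𝒰').cls p y := by
  obtain ⟨a, rfl⟩ := (𝒱.cocycleEquiv 𝒰 p).surjective x
  obtain rfl : 𝒱.cocycleEquiv 𝒰' p (HomologicalComplex.cyclesMap (𝒱.cechComplex.map φ.op) p a) = y :=
    Subtype.ext ((𝒱.cocycleEquiv_map φ a).trans h)
  rw [cls_cocycleEquiv, cls_cocycleEquiv]
  exact congrArg (fun f => f.hom a)
    (HomologicalComplex.homologyπ_naturality (𝒱.cechComplex.map φ.op) p)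

lemma map_vacClass (𝒱 : VertexAlgebraSheaf.{w} J k) {𝒰 𝒰' : FormalCoproduct.{w} C}
    (φ : 𝒰' ⟶ 𝒰) : (𝒱.cechFunctor 0).map φ.op (𝒱.vacClass 𝒰) = 𝒱.vacClass 𝒰' :=
  𝒱.map_cls φ _ _ (𝒱.cechHom_vac φ 1)

lemma map_cohomologyProd (𝒱 : VertexAlgebraSheaf.{w} J k) {𝒰 𝒰' : FormalCoproduct.{w} C}
    (φ : 𝒰' ⟶ 𝒰) (n : ℤ) {p q : ℕ} (x : 𝒱.familyCohomology 𝒰 p) (y : 𝒱.familyCohomology 𝒰 q) :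
    (𝒱.cechFunctor (p + q)).map φ.op (𝒱.cohomologyProd 𝒰 n x y)
      = 𝒱.cohomologyProd 𝒰' n ((𝒱.cechFunctor p).map φ.op x) ((𝒱.cechFunctor q).map φ.op y) := by
  obtain ⟨a, rfl⟩ := (𝒱.cechCohomology 𝒰).surjective p x
  obtain ⟨b, rfl⟩ := (𝒱.cechCohomology 𝒰).surjective q y
  have hd : ∀ {m : ℕ} (z : (𝒱.cechSystem 𝒰).Z m),
      (𝒱.cechHom φ).app (m + 1) z.1 ∈ (𝒱.cechSystem 𝒰').Z m := fun z => by
    have h := (𝒱.cechHom φ).app_d _ z.1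
    rw [show (𝒱.cechSystem 𝒰).d _ z.1 = 0 from z.2, map_zero] at h
    exact h.symm
  rw [𝒱.map_cls φ a ⟨_, hd a⟩ rfl, 𝒱.map_cls φ b ⟨_, hd b⟩ rfl]
  refine (congrArg _ ((𝒱.cechCohomology 𝒰).prod_cls _ _ _)).trans
    (Eq.trans ?_ ((𝒱.cechCohomology 𝒰').prod_cls _ _ _).symm)
  refine 𝒱.map_cls φ _ _ ?_
  change (𝒱.cechHom φ).app _ (((𝒱.cechProducts 𝒰).prod n).app _ _ _) = _
  rw [cechHom_prod, SymModule.Hom.app_map, SymModule.Hom.app_map]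
  rfl

/-- The graded vertex algebra structure on the Čech cohomology of a finite family. -/
noncomputable def familyGradedVertexAlgebra (𝒱 : VertexAlgebraSheaf.{w} J k)
    (𝒰 : FormalCoproduct.{w} C) [Finite 𝒰.I] :
    GradedVertexAlgebra k (fun p => 𝒱.familyCohomology 𝒰 p) :=
  (𝒱.cechCohomology 𝒰).gradedVertexAlgebra (𝒱.cechProducts 𝒰) (𝒱.cechProducts_isVertexAlgebra 𝒰)

lemma familyGradedVertexAlgebra_isInduced (𝒱 : VertexAlgebraSheaf.{w} J k)
    (𝒰 : FormalCoproduct.{w} C) [Finite 𝒰.I] :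
    𝒱.IsInduced 𝒰 (𝒱.familyGradedVertexAlgebra 𝒰) fun _ => LinearMap.id :=
  ⟨𝒱.exists_isVacuum 𝒰, fun n _ _ a b => 𝒱.exists_isCupProduct 𝒰 n a b⟩

end VertexAlgebraSheaf

/-- A bilinear map on quotients, from a bilinear map which vanishes on the kernels. -/
noncomputable def LinearMap.descend₂ {k M N M' N' P : Type*} [Field k] [AddCommGroup M] [Module k M]
    [AddCommGroup N] [Module k N] [AddCommGroup M'] [Module k M'] [AddCommGroup N'] [Module k N']
    [AddCommGroup P] [Module k P] (π : M →ₗ[k] M') (π' : N →ₗ[k] N')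
    (hπ : Function.Surjective π) (hπ' : Function.Surjective π') (B : M →ₗ[k] N →ₗ[k] P)
    (hB : ∀ x y, π x = 0 → B x y = 0) (hB' : ∀ x y, π' y = 0 → B x y = 0) :
    M' →ₗ[k] N' →ₗ[k] P :=
  have hl : ∀ x x' y, π x = π x' → B x y = B x' y := fun x x' y h => by
    rw [← sub_eq_zero, ← LinearMap.sub_apply, ← map_sub]
    exact hB _ _ (by rw [map_sub, h, sub_self])
  have hr : ∀ x y y', π' y = π' y' → B x y = B x y' := fun x y y' h => by
    rw [← sub_eq_zero, ← map_sub]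
    exact hB' _ _ (by rw [map_sub, h, sub_self])
  LinearMap.mk₂ k (fun x y => B (Function.surjInv hπ x) (Function.surjInv hπ' y))
    (fun x x' y => by
      rw [← LinearMap.add_apply, ← map_add]
      exact hl _ _ _ (by simp [Function.surjInv_eq]))
    (fun c x y => by
      rw [← LinearMap.smul_apply, ← map_smul]
      exact hl _ _ _ (by simp [Function.surjInv_eq]))
    (fun x y y' => by
      rw [← map_add]
      exact hr _ _ _ (by simp [Function.surjInv_eq]))
    (fun c x y => by
      rw [← map_smul]
      exact hr _ _ _ (by simp [Function.surjInv_eq]))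

lemma LinearMap.descend₂_apply {k M N M' N' P : Type*} [Field k] [AddCommGroup M] [Module k M]
    [AddCommGroup N] [Module k N] [AddCommGroup M'] [Module k M'] [AddCommGroup N'] [Module k N']
    [AddCommGroup P] [Module k P] (π : M →ₗ[k] M') (π' : N →ₗ[k] N')
    (hπ : Function.Surjective π) (hπ' : Function.Surjective π') (B : M →ₗ[k] N →ₗ[k] P)
    (hB : ∀ x y, π x = 0 → B x y = 0) (hB' : ∀ x y, π' y = 0 → B x y = 0) (x : M) (y : N) :
    LinearMap.descend₂ π π' hπ hπ' B hB hB' (π x) (π' y) = B x y := by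
  change B (Function.surjInv hπ (π x)) (Function.surjInv hπ' (π' y)) = B x y
  rw [← sub_eq_zero, ← sub_add_sub_cancel _ (B x (Function.surjInv hπ' (π' y))) _,
    ← LinearMap.sub_apply, ← map_sub, ← map_sub,
    hB _ _ (by rw [map_sub, Function.surjInv_eq hπ, sub_self]),
    hB' _ _ (by rw [map_sub, Function.surjInv_eq hπ', sub_self]), add_zero]

/-! ### Common refinements of two families. -/

namespace CategoryTheory.Limits.FormalCoproduct

variable {C : Type u} [Category.{v} C] [HasFiniteProducts C]

/-- The family of the products of the members of two families. -/
noncomputable def inter (𝒰 𝒰' : FormalCoproduct.{w} C) : FormalCoproduct.{w} C where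
  I := 𝒰.I × 𝒰'.I
  obj i := 𝒰.obj i.1 ⨯ 𝒰'.obj i.2

/-- The refinement map to the first family. -/
noncomputable def interFst (𝒰 𝒰' : FormalCoproduct.{w} C) : 𝒰.inter 𝒰' ⟶ 𝒰 :=
  Hom.mk (fun i => i.1) fun _ => prod.fst

/-- The refinement map to the second family. -/
noncomputable def interSnd (𝒰 𝒰' : FormalCoproduct.{w} C) : 𝒰.inter 𝒰' ⟶ 𝒰' :=
  Hom.mk (fun i => i.2) fun _ => prod.snd

/-- The universal property of the family of products. -/
noncomputable def interLift {𝒰 𝒰' 𝒲 : FormalCoproduct.{w} C} (φ : 𝒲 ⟶ 𝒰) (ψ : 𝒲 ⟶ 𝒰') :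
    𝒲 ⟶ 𝒰.inter 𝒰' :=
  Hom.mk (fun i => (φ.f i, ψ.f i)) fun i => prod.lift (φ.φ i) (ψ.φ i)

lemma interLift_fst {𝒰 𝒰' 𝒲 : FormalCoproduct.{w} C} (φ : 𝒲 ⟶ 𝒰) (ψ : 𝒲 ⟶ 𝒰') :
    interLift φ ψ ≫ 𝒰.interFst 𝒰' = φ :=
  hom_ext rfl fun _ => (Category.comp_id _).trans (prod.lift_fst _ _)

lemma interLift_snd {𝒰 𝒰' 𝒲 : FormalCoproduct.{w} C} (φ : 𝒲 ⟶ 𝒰) (ψ : 𝒲 ⟶ 𝒰') :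
    interLift φ ψ ≫ 𝒰.interSnd 𝒰' = ψ :=
  hom_ext rfl fun _ => (Category.comp_id _).trans (prod.lift_snd _ _)

end CategoryTheory.Limits.FormalCoproduct

/-! ### Products on the colimit over coverings. -/

namespace VertexAlgebraSheaf

open FormalCoproduct

variable {C : Type u} [Category.{v} C] [HasFiniteProducts C] {J : GrothendieckTopology C}
  {k : Type t} [Field k]

/-- The map on cohomology induced by a refinement map. -/
noncomputable def pull (𝒱 : VertexAlgebraSheaf.{w} J k) {𝒰 𝒰' : FormalCoproduct.{w} C}
    (φ : 𝒰' ⟶ 𝒰) (p : ℕ) : 𝒱.familyCohomology 𝒰 p →ₗ[k] 𝒱.familyCohomology 𝒰' p :=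
  ((𝒱.cechFunctor p).map φ.op).hom

lemma pull_pull (𝒱 : VertexAlgebraSheaf.{w} J k) {𝒰 𝒰' 𝒰'' : FormalCoproduct.{w} C}
    (φ : 𝒰' ⟶ 𝒰) (ψ : 𝒰'' ⟶ 𝒰') {p : ℕ} (x : 𝒱.familyCohomology 𝒰 p) :
    𝒱.pull ψ p (𝒱.pull φ p x) = 𝒱.pull (ψ ≫ φ) p x := by
  simp only [pull, op_comp, Functor.map_comp]
  rfl

lemma pull_id (𝒱 : VertexAlgebraSheaf.{w} J k) (𝒰 : FormalCoproduct.{w} C) {p : ℕ}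
    (x : 𝒱.familyCohomology 𝒰 p) : 𝒱.pull (𝟙 𝒰) p x = x :=
  congrArg (fun f => f.hom x) ((𝒱.cechFunctor p).map_id (op 𝒰))

lemma pull_cohomologyProd (𝒱 : VertexAlgebraSheaf.{w} J k) {𝒰 𝒰' : FormalCoproduct.{w} C}
    (φ : 𝒰' ⟶ 𝒰) (n : ℤ) {p q : ℕ} (x : 𝒱.familyCohomology 𝒰 p) (y : 𝒱.familyCohomology 𝒰 q) :
    𝒱.pull φ (p + q) (𝒱.cohomologyProd 𝒰 n x y)
      = 𝒱.cohomologyProd 𝒰' n (𝒱.pull φ p x) (𝒱.pull φ q y) := 𝒱.map_cohomologyProd φ n x y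

variable {Q : ObjectProperty (FormalCoproduct.{w} C)}

lemma toColimit_pull (𝒱 : VertexAlgebraSheaf.{w} J k) {𝒰 𝒰' : Q.FullSubcategory}
    (φ : 𝒰'.obj ⟶ 𝒰.obj) {p : ℕ} (x : 𝒱.familyCohomology 𝒰.obj p) :
    𝒱.toColimit Q 𝒰' p (𝒱.pull φ p x) = 𝒱.toColimit Q 𝒰 p x :=
  (Submodule.Quotient.eq _).2 (Submodule.subset_span ⟨𝒰, 𝒰', φ, x, rfl⟩)

/-- The intersection of two coverings of a class which is stable under intersections. -/
noncomputable abbrev interObj (hQ : ∀ 𝒰 𝒰', Q 𝒰 → Q 𝒰' → Q (inter 𝒰 𝒰'))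
    (𝒰 𝒰' : Q.FullSubcategory) : Q.FullSubcategory :=
  ⟨inter 𝒰.obj 𝒰'.obj, hQ _ _ 𝒰.property 𝒰'.property⟩

/-- Classes on two coverings can be added after pulling both back to the common refinement `inter`,
so a sum of classes on various coverings collapses to a single one. -/
lemma exists_toColimit_eq (𝒱 : VertexAlgebraSheaf.{w} J k)
    (hQ : ∀ 𝒰 𝒰', Q 𝒰 → Q 𝒰' → Q (inter 𝒰 𝒰')) (𝒰₀ : Q.FullSubcategory) {p : ℕ}
    (z : 𝒱.cohomologyColimit Q p) : ∃ 𝒰 x, 𝒱.toColimit Q 𝒰 p x = z := by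
  classical
  obtain ⟨y, rfl⟩ := Submodule.mkQ_surjective _ z
  induction y using DirectSum.induction_on with
  | zero => exact ⟨𝒰₀, 0, (map_zero _).trans (map_zero _).symm⟩
  | of 𝒰 x =>
    refine ⟨𝒰, x, ?_⟩
    simp only [toColimit]
    congr!
  | add y y' h h' =>
    obtain ⟨𝒰, x, hx⟩ := h
    obtain ⟨𝒰', x', hx'⟩ := h'
    refine ⟨interObj hQ 𝒰 𝒰', 𝒱.pull (interFst 𝒰.obj 𝒰'.obj) p x
      + 𝒱.pull (interSnd 𝒰.obj 𝒰'.obj) p x', ?_⟩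
    rw [map_add, map_add, ← hx, ← hx', 𝒱.toColimit_pull (𝒰 := 𝒰), 𝒱.toColimit_pull (𝒰 := 𝒰')]
    rfl

/-- The product of classes on two coverings, in the colimit. -/
noncomputable def interProd (𝒱 : VertexAlgebraSheaf.{w} J k)
    (hQ : ∀ 𝒰 𝒰', Q 𝒰 → Q 𝒰' → Q (inter 𝒰 𝒰')) (n : ℤ) (p q : ℕ) (𝒰 𝒰' : Q.FullSubcategory) :
    𝒱.familyCohomology 𝒰.obj p →ₗ[k] 𝒱.familyCohomology 𝒰'.obj q →ₗ[k]
      𝒱.cohomologyColimit Q (p + q) :=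
  ((𝒱.cohomologyProd (inter 𝒰.obj 𝒰'.obj) n).compl₁₂ (𝒱.pull (interFst 𝒰.obj 𝒰'.obj) p)
    (𝒱.pull (interSnd 𝒰.obj 𝒰'.obj) q)).compr₂ (𝒱.toColimit Q (interObj hQ 𝒰 𝒰') (p + q))

/-- Every common refinement factors through `inter`, hence computes the same product. The colimit
identifies classes along all refinement maps, so it is not needed that two such maps agree on
cohomology. -/
lemma interProd_apply (𝒱 : VertexAlgebraSheaf.{w} J k)
    (hQ : ∀ 𝒰 𝒰', Q 𝒰 → Q 𝒰' → Q (inter 𝒰 𝒰')) (n : ℤ) {p q : ℕ} {𝒰 𝒰' 𝒲 : Q.FullSubcategory}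
    (φ : 𝒲.obj ⟶ 𝒰.obj) (ψ : 𝒲.obj ⟶ 𝒰'.obj) (x : 𝒱.familyCohomology 𝒰.obj p)
    (y : 𝒱.familyCohomology 𝒰'.obj q) : 𝒱.interProd hQ n p q 𝒰 𝒰' x y
      = 𝒱.toColimit Q 𝒲 (p + q) (𝒱.cohomologyProd 𝒲.obj n (𝒱.pull φ p x) (𝒱.pull ψ q y)) := by
  change 𝒱.toColimit Q (interObj hQ 𝒰 𝒰') (p + q) (𝒱.cohomologyProd _ n _ _) = _
  rw [← 𝒱.toColimit_pull (𝒰 := interObj hQ 𝒰 𝒰') (interLift φ ψ), pull_cohomologyProd, pull_pull,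
    pull_pull, interLift_fst, interLift_snd]

lemma interProd_pull (𝒱 : VertexAlgebraSheaf.{w} J k)
    (hQ : ∀ 𝒰 𝒰', Q 𝒰 → Q 𝒰' → Q (inter 𝒰 𝒰')) (n : ℤ) {p q : ℕ} {𝒰 𝒰' 𝒲 𝒲' : Q.FullSubcategory}
    (φ : 𝒲.obj ⟶ 𝒰.obj) (ψ : 𝒲'.obj ⟶ 𝒰'.obj) (x : 𝒱.familyCohomology 𝒰.obj p)
    (y : 𝒱.familyCohomology 𝒰'.obj q) :
    𝒱.interProd hQ n p q 𝒲 𝒲' (𝒱.pull φ p x) (𝒱.pull ψ q y) = 𝒱.interProd hQ n p q 𝒰 𝒰' x y := by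
  rw [𝒱.interProd_apply hQ n (𝒲 := interObj hQ 𝒲 𝒲') (interFst 𝒲.obj 𝒲'.obj ≫ φ)
    (interSnd 𝒲.obj 𝒲'.obj ≫ ψ), ← pull_pull, ← pull_pull]
  rfl

open Classical in
/-- The product on the direct sum of the cohomology modules of all coverings. -/
noncomputable def sumProd (𝒱 : VertexAlgebraSheaf.{w} J k)
    (hQ : ∀ 𝒰 𝒰', Q 𝒰 → Q 𝒰' → Q (inter 𝒰 𝒰')) (n : ℤ) (p q : ℕ) :
    (DirectSum Q.FullSubcategory fun 𝒰 => 𝒱.familyCohomology 𝒰.obj p) →ₗ[k]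
    (DirectSum Q.FullSubcategory fun 𝒰 => 𝒱.familyCohomology 𝒰.obj q) →ₗ[k]
      𝒱.cohomologyColimit Q (p + q) :=
  DirectSum.toModule k _ _ fun 𝒰 =>
    (DirectSum.toModule k _ _ fun 𝒰' => (𝒱.interProd hQ n p q 𝒰 𝒰').flip).flip

open Classical in
lemma sumProd_lof (𝒱 : VertexAlgebraSheaf.{w} J k)
    (hQ : ∀ 𝒰 𝒰', Q 𝒰 → Q 𝒰' → Q (inter 𝒰 𝒰')) (n : ℤ) {p q : ℕ} (𝒰 𝒰' : Q.FullSubcategory)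
    (x : 𝒱.familyCohomology 𝒰.obj p) (y : 𝒱.familyCohomology 𝒰'.obj q) :
    𝒱.sumProd hQ n p q
        (DirectSum.lof k Q.FullSubcategory (fun 𝒰 => 𝒱.familyCohomology 𝒰.obj p) 𝒰 x)
        (DirectSum.lof k Q.FullSubcategory (fun 𝒰 => 𝒱.familyCohomology 𝒰.obj q) 𝒰' y)
      = 𝒱.interProd hQ n p q 𝒰 𝒰' x y := by
  rw [sumProd, DirectSum.toModule_lof, LinearMap.flip_apply, DirectSum.toModule_lof,
    LinearMap.flip_apply]

lemma sumProd_eq_zero_left (𝒱 : VertexAlgebraSheaf.{w} J k)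
    (hQ : ∀ 𝒰 𝒰', Q 𝒰 → Q 𝒰' → Q (inter 𝒰 𝒰')) (n : ℤ) {p q : ℕ}
    (x : DirectSum Q.FullSubcategory fun 𝒰 => 𝒱.familyCohomology 𝒰.obj p)
    (hx : x ∈ 𝒱.refinementRelations Q p) : 𝒱.sumProd hQ n p q x = 0 := by
  classical
  refine Submodule.span_induction (p := fun x _ => 𝒱.sumProd hQ n p q x = 0) ?_ (map_zero _)
    (fun x y _ _ hx hy => by rw [map_add, hx, hy, add_zero])
    (fun c x _ hx => by rw [map_smul, hx, smul_zero]) hx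
  rintro _ ⟨𝒰, 𝒰', φ, x, rfl⟩
  apply DirectSum.linearMap_ext
  intro 𝒲
  ext y
  have h1 := 𝒱.sumProd_lof hQ n 𝒰' 𝒲 (𝒱.pull φ p x) y
  have h2 := 𝒱.sumProd_lof hQ n 𝒰 𝒲 x y
  -- Refining only the left covering, with the identity on the other, shows that both terms of the
  -- relation have the same product with `y`.
  have h3 := 𝒱.interProd_pull hQ n (𝒰 := 𝒰) (𝒲 := 𝒰') (𝒲' := 𝒲) (𝒰' := 𝒲) φ (𝟙 𝒲.obj) x y
  rw [pull_id, ← h1, ← h2, ← sub_eq_zero] at h3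
  rw [← LinearMap.sub_apply, ← map_sub] at h3
  exact h3

lemma sumProd_eq_zero_right (𝒱 : VertexAlgebraSheaf.{w} J k)
    (hQ : ∀ 𝒰 𝒰', Q 𝒰 → Q 𝒰' → Q (inter 𝒰 𝒰')) (n : ℤ) {p q : ℕ}
    (y : DirectSum Q.FullSubcategory fun 𝒰 => 𝒱.familyCohomology 𝒰.obj q)
    (hy : y ∈ 𝒱.refinementRelations Q q) : (𝒱.sumProd hQ n p q).flip y = 0 := by
  classical
  refine Submodule.span_induction (p := fun y _ => (𝒱.sumProd hQ n p q).flip y = 0) ?_ (map_zero _)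
    (fun x y _ _ hx hy => by rw [map_add, hx, hy, add_zero])
    (fun c x _ hx => by rw [map_smul, hx, smul_zero]) hy
  rintro _ ⟨𝒰, 𝒰', φ, y, rfl⟩
  apply DirectSum.linearMap_ext
  intro 𝒲
  ext x
  have h1 := 𝒱.sumProd_lof hQ n 𝒲 𝒰' x (𝒱.pull φ q y)
  have h2 := 𝒱.sumProd_lof hQ n 𝒲 𝒰 x y
  have h3 := 𝒱.interProd_pull hQ n (𝒰 := 𝒲) (𝒲 := 𝒲) (𝒲' := 𝒰') (𝒰' := 𝒰) (𝟙 𝒲.obj) φ x y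
  rw [pull_id, ← h1, ← h2, ← sub_eq_zero] at h3
  rw [← map_sub] at h3
  exact h3

/-- The product on the colimit. -/
noncomputable def colimitProd (𝒱 : VertexAlgebraSheaf.{w} J k)
    (hQ : ∀ 𝒰 𝒰', Q 𝒰 → Q 𝒰' → Q (inter 𝒰 𝒰')) (n : ℤ) {p q : ℕ} :
    𝒱.cohomologyColimit Q p →ₗ[k] 𝒱.cohomologyColimit Q q →ₗ[k] 𝒱.cohomologyColimit Q (p + q) :=
  LinearMap.descend₂ (𝒱.refinementRelations Q p).mkQ (𝒱.refinementRelations Q q).mkQ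
    (Submodule.mkQ_surjective _) (Submodule.mkQ_surjective _) (𝒱.sumProd hQ n p q)
    (fun x y hx => by
      rw [𝒱.sumProd_eq_zero_left hQ n x ((Submodule.Quotient.mk_eq_zero _).1 hx),
        LinearMap.zero_apply])
    (fun x y hy => by
      rw [← LinearMap.flip_apply,
        𝒱.sumProd_eq_zero_right hQ n y ((Submodule.Quotient.mk_eq_zero _).1 hy),
        LinearMap.zero_apply])

lemma colimitProd_toColimit (𝒱 : VertexAlgebraSheaf.{w} J k)
    (hQ : ∀ 𝒰 𝒰', Q 𝒰 → Q 𝒰' → Q (inter 𝒰 𝒰')) (n : ℤ) {p q : ℕ} (𝒰 : Q.FullSubcategory)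
    (x : 𝒱.familyCohomology 𝒰.obj p) (y : 𝒱.familyCohomology 𝒰.obj q) :
    𝒱.colimitProd hQ n (𝒱.toColimit Q 𝒰 p x) (𝒱.toColimit Q 𝒰 q y)
      = 𝒱.toColimit Q 𝒰 (p + q) (𝒱.cohomologyProd 𝒰.obj n x y) := by
  refine (LinearMap.descend₂_apply _ _ _ _ _ _ _ _ _).trans ?_
  rw [sumProd_lof, 𝒱.interProd_apply hQ n (𝒲 := 𝒰) (𝟙 _) (𝟙 _), pull_id, pull_id]

lemma toColimit_vacClass (𝒱 : VertexAlgebraSheaf.{w} J k)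
    (hQ : ∀ 𝒰 𝒰', Q 𝒰 → Q 𝒰' → Q (inter 𝒰 𝒰')) (𝒰 𝒰' : Q.FullSubcategory) :
    𝒱.toColimit Q 𝒰 0 (𝒱.vacClass 𝒰.obj) = 𝒱.toColimit Q 𝒰' 0 (𝒱.vacClass 𝒰'.obj) := by
  rw [← 𝒱.toColimit_pull (𝒰 := 𝒰) (𝒰' := interObj hQ 𝒰 𝒰') (interFst 𝒰.obj 𝒰'.obj),
    ← 𝒱.toColimit_pull (𝒰 := 𝒰') (𝒰' := interObj hQ 𝒰 𝒰') (interSnd 𝒰.obj 𝒰'.obj)]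
  congr 1
  exact (𝒱.map_vacClass _).trans (𝒱.map_vacClass _).symm

/-- Any three classes in the colimit come from a common finite covering. -/
lemma exists_finite_toColimit_eq (𝒱 : VertexAlgebraSheaf.{w} J k)
    (hQ : ∀ 𝒰 𝒰', Q 𝒰 → Q 𝒰' → Q (inter 𝒰 𝒰')) (𝒰₀ : Q.FullSubcategory)
    (hfin : ∀ 𝒰, Q 𝒰 → ∃ 𝒰', Q 𝒰' ∧ Finite 𝒰'.I ∧ Nonempty (𝒰' ⟶ 𝒰))
    {p q r : ℕ} (a : 𝒱.cohomologyColimit Q p)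
    (b : 𝒱.cohomologyColimit Q q) (c : 𝒱.cohomologyColimit Q r) :
    ∃ (𝒰 : Q.FullSubcategory) (_ : Finite 𝒰.obj.I) (x : 𝒱.familyCohomology 𝒰.obj p)
      (y : 𝒱.familyCohomology 𝒰.obj q) (z : 𝒱.familyCohomology 𝒰.obj r),
      𝒱.toColimit Q 𝒰 p x = a ∧ 𝒱.toColimit Q 𝒰 q y = b ∧ 𝒱.toColimit Q 𝒰 r z = c := by
  obtain ⟨𝒰₁, x, rfl⟩ := 𝒱.exists_toColimit_eq hQ 𝒰₀ a
  obtain ⟨𝒰₂, y, rfl⟩ := 𝒱.exists_toColimit_eq hQ 𝒰₀ b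
  obtain ⟨𝒰₃, z, rfl⟩ := 𝒱.exists_toColimit_eq hQ 𝒰₀ c
  -- A finite refinement of the triple intersection maps to all three coverings.
  obtain ⟨𝒲, hW, hW', ⟨φ⟩⟩ := hfin (inter 𝒰₁.obj (inter 𝒰₂.obj 𝒰₃.obj))
    (hQ _ _ 𝒰₁.property (hQ _ _ 𝒰₂.property 𝒰₃.property))
  refine ⟨⟨𝒲, hW⟩, hW', 𝒱.pull (φ ≫ interFst _ _) p x,
    𝒱.pull (φ ≫ interSnd _ _ ≫ interFst _ _) q y, 𝒱.pull (φ ≫ interSnd _ _ ≫ interSnd _ _) r z,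
    ?_, ?_, ?_⟩
  · exact 𝒱.toColimit_pull (𝒰 := 𝒰₁) (𝒰' := ⟨𝒲, hW⟩) _ x
  · exact 𝒱.toColimit_pull (𝒰 := 𝒰₂) (𝒰' := ⟨𝒲, hW⟩) _ y
  · exact 𝒱.toColimit_pull (𝒰 := 𝒰₃) (𝒰' := ⟨𝒲, hW⟩) _ z

/-- The graded vertex algebra structure on the colimit. -/
theorem exists_gradedVertexAlgebra_colimit (𝒱 : VertexAlgebraSheaf.{w} J k)
    (hQ : ∀ 𝒰 𝒰', Q 𝒰 → Q 𝒰' → Q (inter 𝒰 𝒰')) (𝒰₀ : Q.FullSubcategory)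
    (hfin : ∀ 𝒰, Q 𝒰 → ∃ 𝒰', Q 𝒰' ∧ Finite 𝒰'.I ∧ Nonempty (𝒰' ⟶ 𝒰)) :
    ∃ S : GradedVertexAlgebra k (fun p => 𝒱.cohomologyColimit Q p),
      ∀ 𝒰 : Q.FullSubcategory, 𝒱.IsInduced 𝒰.obj S (𝒱.toColimit Q 𝒰) := by
  -- These maps carry the identities, stated in the direct sum over all degrees, from a finite
  -- covering to the colimit.
  let f : ∀ (𝒰 : Q.FullSubcategory), (DirectSum ℕ fun p => 𝒱.familyCohomology 𝒰.obj p) →+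
      (DirectSum ℕ fun p => 𝒱.cohomologyColimit Q p) :=
    fun 𝒰 => DirectSum.map fun p => (𝒱.toColimit Q 𝒰 p).toAddMonoidHom
  have hf : ∀ (𝒰 : Q.FullSubcategory) {p : ℕ} (x : 𝒱.familyCohomology 𝒰.obj p),
      DirectSum.of (fun p => 𝒱.cohomologyColimit Q p) p (𝒱.toColimit Q 𝒰 p x)
        = f 𝒰 (DirectSum.of (fun p => 𝒱.familyCohomology 𝒰.obj p) p x) := fun 𝒰 p x =>
    (DirectSum.map_of (fun p => (𝒱.toColimit Q 𝒰 p).toAddMonoidHom) p x).symm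
  refine ⟨.ofSum (𝒱.toColimit Q 𝒰₀ 0 (𝒱.vacClass 𝒰₀.obj)) (fun n _ _ => 𝒱.colimitProd hQ n)
    ?_ ?_ ?_ ?_ ?_, ?_⟩
  · intro i j a b
    obtain ⟨𝒰, _, x, y, -, rfl, rfl, -⟩ := 𝒱.exists_finite_toColimit_eq hQ 𝒰₀ hfin a b a
    obtain ⟨N, hN⟩ := (𝒱.familyGradedVertexAlgebra 𝒰.obj).truncation x y
    refine ⟨N, fun n hn => ?_⟩
    rw [colimitProd_toColimit]
    exact (congrArg _ (hN n hn)).trans (map_zero _)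
  · intro n i a
    obtain ⟨𝒰, _, x, -, -, rfl, -, -⟩ := 𝒱.exists_finite_toColimit_eq hQ 𝒰₀ hfin a a a
    rw [𝒱.toColimit_vacClass hQ 𝒰₀ 𝒰, colimitProd_toColimit, hf]
    refine (congrArg (f 𝒰) ((𝒱.familyGradedVertexAlgebra 𝒰.obj).vac_prod n x)).trans ?_
    rw [hf, apply_ite (f 𝒰), map_zero]
  · intro i a
    obtain ⟨𝒰, _, x, -, -, rfl, -, -⟩ := 𝒱.exists_finite_toColimit_eq hQ 𝒰₀ hfin a a a
    rw [𝒱.toColimit_vacClass hQ 𝒰₀ 𝒰, colimitProd_toColimit, hf]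
    refine (congrArg (f 𝒰) ((𝒱.familyGradedVertexAlgebra 𝒰.obj).prod_vac x)).trans ?_
    rw [hf]
  · intro n i a hn
    obtain ⟨𝒰, _, x, -, -, rfl, -, -⟩ := 𝒱.exists_finite_toColimit_eq hQ 𝒰₀ hfin a a a
    rw [𝒱.toColimit_vacClass hQ 𝒰₀ 𝒰, colimitProd_toColimit]
    exact (congrArg _ ((𝒱.familyGradedVertexAlgebra 𝒰.obj).prod_vac_of_nonneg n x hn)).trans
      (map_zero _)
  · intro p q r α β γ a b c
    obtain ⟨𝒰, _, x, y, z, rfl, rfl, rfl⟩ := 𝒱.exists_finite_toColimit_eq hQ 𝒰₀ hfin a b c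
    obtain ⟨N, hN⟩ := (𝒱.cechCohomology 𝒰.obj).borcherds (𝒱.cechProducts 𝒰.obj)
      (𝒱.cechProducts_isVertexAlgebra 𝒰.obj) p q r x y z
    refine ⟨N, fun M hM => ?_⟩
    have h := congrArg (f 𝒰) (hN M hM)
    simp only [map_sum, map_zsmul, map_sub, Units.smul_def] at h
    simp only [colimitProd_toColimit, hf, Units.smul_def]
    exact h
  · intro 𝒰
    refine ⟨?_, fun n p q a b => ?_⟩
    · obtain ⟨e, he, he'⟩ := 𝒱.exists_isVacuum 𝒰.obj
      exact ⟨e, he, (𝒱.toColimit_vacClass hQ 𝒰₀ 𝒰).trans (congrArg _ he')⟩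
    · obtain ⟨c, hc, hc'⟩ := 𝒱.exists_isCupProduct 𝒰.obj n a b
      exact ⟨c, hc, (𝒱.colimitProd_toColimit hQ n 𝒰 _ _).trans (congrArg _ hc')⟩

end VertexAlgebraSheaf

/-! ### Stability properties of coverings, and the theorem. -/

namespace CategoryTheory.GrothendieckTopology

open FormalCoproduct

variable {C : Type u} [Category.{v} C] [HasFiniteProducts C] (J : GrothendieckTopology C)

/-- An object over `W` that maps to some `U_i` and to some `U'_{i'}` maps to their product, so the
sieve of the product family contains the intersection of the two covering sieves. -/
lemma coverings_inter (𝒰 𝒰' : FormalCoproduct.{w} C) (h : J.coverings 𝒰) (h' : J.coverings 𝒰') :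
    J.coverings (inter 𝒰 𝒰') := fun W => by
  refine J.superset_covering ?_ (J.intersection_covering (h W) (h' W))
  rintro Z g ⟨⟨i, ⟨f⟩⟩, ⟨i', ⟨f'⟩⟩⟩
  exact ⟨(i, i'), ⟨prod.lift f f'⟩⟩

lemma finiteCoverings_inter (𝒰 𝒰' : FormalCoproduct.{w} C) (h : J.finiteCoverings 𝒰)
    (h' : J.finiteCoverings 𝒰') : J.finiteCoverings (inter 𝒰 𝒰') := by
  have := h.2
  have := h'.2
  exact ⟨J.coverings_inter 𝒰 𝒰' h.1 h'.1, inferInstanceAs (Finite (𝒰.I × 𝒰'.I))⟩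

lemma finiteCoverings_incl_terminal :
    J.finiteCoverings ((FormalCoproduct.incl.{w} C).obj (⊤_ C)) := by
  refine ⟨fun W => ?_, inferInstanceAs (Finite PUnit)⟩
  refine J.superset_covering ?_ (J.top_mem W)
  rintro Z g -
  exact ⟨PUnit.unit, ⟨terminal.from Z⟩⟩

end CategoryTheory.GrothendieckTopology

/-- Let `𝒱` be a sheaf of vertex algebras on a site with finite products (in particular with a
terminal object), for example on the site of open subsets of a topological space.  The products `a_(n) b` of sections make the following into
`ℤ_{≥0}`-graded vertex algebras: the Čech cohomology of each finite covering, its colimit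
over all finite coverings, and, if the site is quasi-compact, the colimit over all coverings. -/
theorem corollary4p6 {C : Type u} [Category.{v} C] [HasFiniteProducts C]
    (J : GrothendieckTopology C) (k : Type t) [Field k] [CharZero k]
    (𝒱 : VertexAlgebraSheaf.{w} J k) :
    (∀ 𝒰 : FormalCoproduct.{w} C, J.finiteCoverings 𝒰 →
      ∃ S : GradedVertexAlgebra k (fun p => 𝒱.familyCohomology 𝒰 p),
        𝒱.IsInduced 𝒰 S fun _ => LinearMap.id) ∧
    (∃ S : GradedVertexAlgebra k
        (fun p => 𝒱.cohomologyColimit J.finiteCoverings p),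
      ∀ 𝒰 : J.finiteCoverings.FullSubcategory,
        𝒱.IsInduced 𝒰.obj S (𝒱.toColimit J.finiteCoverings 𝒰)) ∧
    (GrothendieckTopology.IsQuasiCompact.{w} J →
      ∃ S : GradedVertexAlgebra k
          (fun p => 𝒱.cohomologyColimit J.coverings p),
        ∀ 𝒰 : J.coverings.FullSubcategory,
          𝒱.IsInduced 𝒰.obj S (𝒱.toColimit J.coverings 𝒰)) := by
  refine ⟨fun 𝒰 h𝒰 => ?_, ?_, fun hJ => ?_⟩
  · have := h𝒰.2
    exact ⟨_, 𝒱.familyGradedVertexAlgebra_isInduced 𝒰⟩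
  -- The terminal object alone is a finite covering, so the class is nonempty; each finite covering
  -- is its own finite refinement.
  · exact 𝒱.exists_gradedVertexAlgebra_colimit J.finiteCoverings_inter
      ⟨_, J.finiteCoverings_incl_terminal⟩ fun 𝒰 h => ⟨𝒰, h, h.2, ⟨𝟙 𝒰⟩⟩
  · refine 𝒱.exists_gradedVertexAlgebra_colimit J.coverings_inter
      ⟨_, J.finiteCoverings_incl_terminal.1⟩ fun 𝒰 h => ?_
    -- A finite subcovering is a finite refinement, by the inclusion of index sets and the identity
    -- morphisms.
    obtain ⟨s, hs⟩ := hJ 𝒰.I 𝒰.obj h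
    exact ⟨⟨s, fun i => 𝒰.obj i⟩, hs, inferInstanceAs (Finite s), ⟨⟨fun i => i.1, fun _ => 𝟙 _⟩⟩⟩
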